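/- Let $q\ge 2$. For each integer $k\ge 1$ let $\Delta^{(k-1)}=\{v\in\mathbb R^k : v_i\ge 0,\ \sum_i v_i=1\}$, with relative interior $\operatorname{int}\Delta^{(k-1)}=\{v\in\Delta^{(k-1)}: v_i>0\ \forall i\}$, and let $E^{(k-1)}=\{x\in\mathbb R^k:\sum_i x_i=0\}$ with the Euclidean structure induced from $\mathbb R^k$. Write $\gamma$ for the standard Gaussian probability measure on $E^{(k-1)}$, with density $e^{-W(y)}=(2\pi)^{-(k-1)/2}e^{-|y|^2/2}$. For $k\geq 2$ set $\gamma^{k-2}:=e^{-W}\mathcal H^{k-2}$, where $\mathcal H^{k-2}$ is the $(k-2)$-dimensional Hausdorff measure. The Gaussian perimeter of $U\subset E^{(k-1)}$ is $$P_\gamma(U)=\sup\Big\{\int_U(\operatorname{div}X-\langle\nabla W,X\rangle)\,d\gamma : X\in C_c^\infty(E^{(k-1)};E^{(k-1)}),\ |X|\le 1\Big\},$$ and that of a $k$-tuple of sets is $P_\gamma(\Omega_1,\dots,\Omega_k)=\frac12\sum_i P_\gamma(\Omega_i)$. Let $\Omega^m_i=\operatorname{int}\{x\in E^{(k-1)}:\max_j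 x_j=x_i\}$ for $i=1,\dots,k$ (the interior being taken in $E^{(k-1)}$), let $x+\Omega^m=(x+\Omega^m_1,\dots,x+\Omega^m_k)$ for $x \in E^{(k-1)}$, let $\Sigma^m_{ij}=\partial\Omega^m_i\cap\partial\Omega^m_j$ and $A^m_{ij}(x)=\gamma^{k-2}(x+\Sigma^m_{ij})$ for $i\ne j$, and let $\Psi(x)=\gamma(x+\Omega^m):=(\gamma(x+\Omega^m_1),\dots,\gamma(x+\Omega^m_k))$. For a symmetric array $A=(A_{ij})_{i\ne j}$ of real numbers let $L_A=\sum_{i<j}A_{ij}(e_i-e_j)(e_i-e_j)^T$, regarded as an operator on $E^{(k-1)}$. The model profile is $$I_m^{(k-1)}(v)=P_\gamma(x+\Omega^m)\quad\text{for } v\in\operatorname{int}\Delta^{(k-1)},\ \text{ where } \Psi(x)=v$$ (for $k=1$ this gives $I^{(0)}_m(1)=0$). Write $E=E^{(q-1)}$, $\Delta=\Delta^{(q-1)}$, $I_m=I_m^{(q-1)}$. Then: 1. $\Psi$ is a ($C^\infty$) diffeomorphism from $E$ onto $\operatorname{int}\Delta$, and $D\Psi(x)=-\frac1{\sqrt2}L_{A^m(x)}$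 for every $x\in E$. Consequently $I_m$ is well defined. 2. For every $x\in E$, $P_\gamma(x+\Omega^m)=\sum_{i<j}A^m_{ij}(x)<\infty$. 3. $I_m$ is $C^\infty$ on $\operatorname{int}\Delta$ and has a continuous extension to $\Delta$. For every $J\subset\{1,\dots,q\}$ with $0<|J|<q$ and every $v\in\Delta$ with $\{i:v_i>0\}=J$, this extension satisfies $I_m(v)=I_m^{(|J|-1)}(v_J)$, where $v_J\in\operatorname{int}\Delta^{(|J|-1)}$ is obtained from $v$ by keeping only the coordinates in $J$. 4. At every point of $\operatorname{int}\Delta$, with gradient and Hessian taken along the tangent space $E$, $$\nabla I_m=\tfrac1{\sqrt2}\,\Psi^{-1},\qquad \nabla^2 I_m=-\big(L_{A^m\circ\Psi^{-1}}\big)^{-1},$$ where $L_{A^m\circ\Psi^{-1}}$ is invertible as an operator on $E$. -/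

import Mathlib

open Set MeasureTheory ProbabilityTheory
open scoped ContDiff RealInnerProductSpace

noncomputable section

namespace GaussianBubble

/-- The hyperplane `E = {x ∈ ℝ^q : ∑ x_i = 0}` with its Euclidean structure. -/
def E (q : ℕ) : Submodule ℝ (EuclideanSpace ℝ (Fin q)) where
  carrier := {x | ∑ i, x i = 0}
  zero_mem' := by simp
  add_mem' := by
    intro a b ha hb
    simp only [mem_ofPred_eq] at ha hb ⊢
    simp [Finset.sum_add_distrib, ha, hb]
  smul_mem' := by
    intro c a ha
    simp only [mem_ofPred_eq] at ha ⊢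
    simp [← Finset.mul_sum, ha]

/-- The probability simplex `Δ ⊂ ℝ^q`. -/
def simplex (q : ℕ) : Set (EuclideanSpace ℝ (Fin q)) :=
  {v | (∀ i, 0 ≤ v i) ∧ ∑ i, v i = 1}

/-- The (relative) interior of the probability simplex. -/
def simplexInterior (q : ℕ) : Set (EuclideanSpace ℝ (Fin q)) :=
  {v | (∀ i, 0 < v i) ∧ ∑ i, v i = 1}

/-- The (relatively open) face `Δ_J = {v ∈ Δ : {i : v_i > 0} = J}`. -/
def face (q : ℕ) (J : Finset (Fin q)) : Set (EuclideanSpace ℝ (Fin q)) :=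
  {v | v ∈ simplex q ∧ {i | 0 < v i} = (J : Set (Fin q))}

/-- The vector `v_J ∈ ℝ^{|J|}`: keep only the coordinates in `J`, in increasing order. -/
def faceProj {q : ℕ} (J : Finset (Fin q)) (v : EuclideanSpace ℝ (Fin q)) :
    EuclideanSpace ℝ (Fin J.card) :=
  WithLp.toLp 2 fun k => v (J.orderEmbOfFin rfl k)

/-- The standard Gaussian probability measure on the `(q-1)`-dimensional Euclidean space `E`. -/
def gauss (q : ℕ) : Measure (E q) := stdGaussian (E q)

/-- The density `e^{-W(y)} = (2π)^{-(q-1)/2} e^{-|y|²/2}` of the standard Gaussian measure on `E`. -/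
def gaussDensity (q : ℕ) (y : E q) : ℝ :=
  (2 * Real.pi) ^ (-((q : ℝ) - 1) / 2) * Real.exp (-‖y‖ ^ 2 / 2)

/-- The Gaussian-weighted surface measure `e^{-W} ℋ^{q-2}` on `E`. Here `μHE[d]` is the Hausdorff
measure with the Euclidean normalization (it is Lebesgue measure on `d`-dimensional subspaces). -/
def gaussSurface (q : ℕ) : Measure (E q) :=
  (μHE[q - 2] : Measure (E q)).withDensity fun y => ENNReal.ofReal (gaussDensity q y)

/-- The Gaussian-weighted perimeter of a set `U ⊆ E`: the supremum of
`∫_U (div X - ⟨∇W, X⟩) dγ` over smooth compactly supported vector fields with `|X| ≤ 1`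
(here `∇W(y) = y`; the field `X = 0` shows that the supremum is nonnegative). -/
def perimeter (q : ℕ) (U : Set (E q)) : ENNReal :=
  ⨆ (X : E q → E q) (_ : ContDiff ℝ ∞ X) (_ : HasCompactSupport X) (_ : ∀ y, ‖X y‖ ≤ 1),
    ENNReal.ofReal
      (∫ y in U, (LinearMap.trace ℝ (E q) (fderiv ℝ X y : E q →ₗ[ℝ] E q) - ⟪y, X y⟫) ∂(gauss q))

/-- The total Gaussian perimeter of a cluster `(Ω_1, …, Ω_q)` in `E`. -/
def clusterPerimeter (q : ℕ) (Ω : Fin q → Set (E q)) : ENNReal :=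
  (1 / 2) * ∑ i, perimeter q (Ω i)

/-- The model cell `Ω^m_i = int {x ∈ E : max_j x_j = x_i}`. -/
def modelCell (q : ℕ) (i : Fin q) : Set (E q) :=
  interior {x | ∀ j, x.1 j ≤ x.1 i}

/-- The model interface `Σ^m_ij = ∂Ω^m_i ∩ ∂Ω^m_j`. -/
def modelInterface (q : ℕ) (i j : Fin q) : Set (E q) :=
  frontier (modelCell q i) ∩ frontier (modelCell q j)

/-- The shift `x + S`. -/
def shift {q : ℕ} (x : E q) (S : Set (E q)) : Set (E q) := (fun y => x + y) '' S

/-- The weighted area `A^m_ij(x) = γ^{q-2}(x + Σ^m_ij)` as a real number. -/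
def modelArea (q : ℕ) (x : E q) (i j : Fin q) : ℝ :=
  (gaussSurface q (shift x (modelInterface q i j))).toReal

/-- `Ψ(x) = γ(x + Ω^m)`, the vector of Gaussian measures of the translated model cells. -/
def Psi (q : ℕ) (x : E q) : EuclideanSpace ℝ (Fin q) :=
  WithLp.toLp 2 fun i => (gauss q (shift x (modelCell q i))).toReal

/-- The inverse of `Ψ` (its values off the range of `Ψ` are irrelevant). -/
def PsiInv (q : ℕ) (v : EuclideanSpace ℝ (Fin q)) : E q := Function.invFun (Psi q) v

/-- The model profile `I_m(v) = P_γ(x + Ω^m)` where `Ψ(x) = v`. -/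
def modelProfile (q : ℕ) (v : EuclideanSpace ℝ (Fin q)) : ℝ :=
  (clusterPerimeter q fun i => shift (PsiInv q v) (modelCell q i)).toReal

/-- The vector `e_i - e_j ∈ E`. -/
def edge (q : ℕ) (i j : Fin q) : E q :=
  ⟨EuclideanSpace.single i 1 - EuclideanSpace.single j 1, by
    change ∑ k, (EuclideanSpace.single i (1 : ℝ) - EuclideanSpace.single j (1 : ℝ) :
      EuclideanSpace ℝ (Fin q)) k = 0
    simp [Finset.sum_sub_distrib]⟩

/-- `L_A = ∑_{i<j} A_ij (e_i - e_j)(e_i - e_j)^T` as an operator on `E`. -/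
def L (q : ℕ) (A : Fin q → Fin q → ℝ) : E q →L[ℝ] E q :=
  ∑ i, ∑ j with i < j, A i j • (innerSL ℝ (edge q i j)).smulRight (edge q i j)

end GaussianBubble

end

open GaussianBubble

/-!
# The model profile of the Gaussian multi-bubble problem

Everything is governed by the convex function `expMax q x = 𝔼 max_i (Y_i - x_i)`, where `Y` is a
standard Gaussian vector on `E`.

**Divergence theorem.** For a fixed `i` the functionals `y ↦ y_i - y_j`, `j ≠ i`, have a dual basis
`dualVec q j`, so the `j`-th component of a vector field can be integrated along a direction that
moves only the `j`-th facet of the `i`-th cell. Fubini's theorem along this oblique direction and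
the fundamental theorem of calculus (`integral_halfSpace_fderiv`) then give the Gauss–Green formula
`integral_cell_divergence`, in which the facets carry the measure `e^{-W} ℋ^{q-2}`. It bounds the
perimeter of a cell by the total area of its facets, and the fields `facetField`, which converge to
the outer normal on each facet, show that the bound is attained (`perimeter_cell`). For constant
fields it computes the first moments of the cells (`integral_cell_inner`).

**The map `Ψ`.** Up to a Gaussian factor, `Ψ_i(x)` is a Laplace transform of the Gaussian measure
restricted to a cone, hence smooth, and its differential is given by a first moment, which is
`-L_A / √2` (`hasFDerivAt_Psi`). All areas are positive, so `L_A` is positive definite; therefore `Ψ`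
is strictly monotone, hence injective, and its inverse is smooth by the inverse function theorem.
On the cell `i` the maximum `max_j (y_j - x_j)` is attained at `i`, so `-Ψ(x)` is a subgradient of
`expMax` at `x` (`expMax_sub_le`). For `v` in the interior of the simplex `x ↦ expMax x + ⟪v, x⟫` is
coercive on `E`, and its minimizer solves `Ψ(x) = v` (`exists_Psi_eq`).

**The profile.** Summing first moments over the cells gives
`expMax x + ⟪Ψ(x), x⟫ = √2 ∑_{i<j} A_ij(x)` (`expMax_add_inner`), so that `√2 I_m` is the concave
conjugate `v ↦ inf_x (expMax x + ⟪v, x⟫)` of `expMax` (`modelProfile_eq_expMaxEnvelope`). Its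
gradient is the minimizer `Ψ⁻¹(v)`, which gives the gradient and the Hessian of `I_m`. The conjugate
makes sense on the whole simplex. It is upper semicontinuous as an infimum of affine functions, and
lower semicontinuous since it is nonnegative and concave on a simplex
(`continuousOn_expMaxEnvelope`). On a face the coordinates of `x` outside `J` only enter through the
maximum and may be sent to `+∞`; what remains is the lower-dimensional conjugate, because marginals
of standard Gaussian measures are standard Gaussian (`expMaxEnvelope_comp`).
-/

namespace GaussianBubble

open Filter Topology Module

/-! ### The Gaussian density and slicing by hyperplanes -/

section Measure

variable {V : Type*} [NormedAddCommGroup V] [InnerProductSpace ℝ V] [FiniteDimensional ℝ V]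
  [MeasurableSpace V] [BorelSpace V]

/-- The density of the standard Gaussian measure of a Euclidean space with respect to Lebesgue
measure. -/
noncomputable def stdGaussianDensity (V : Type*) [NormedAddCommGroup V] [InnerProductSpace ℝ V]
    (y : V) : ℝ :=
  (2 * Real.pi) ^ (-(finrank ℝ V : ℝ) / 2) * Real.exp (-‖y‖ ^ 2 / 2)

omit [FiniteDimensional ℝ V] [MeasurableSpace V] [BorelSpace V] in
lemma stdGaussianDensity_pos (y : V) : 0 < stdGaussianDensity V y := by
  unfold stdGaussianDensity; positivity

omit [FiniteDimensional ℝ V] [MeasurableSpace V] [BorelSpace V] in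
lemma continuous_stdGaussianDensity : Continuous (stdGaussianDensity V) := by
  unfold stdGaussianDensity; fun_prop

lemma integrable_stdGaussianDensity : Integrable (stdGaussianDensity V) := by
  unfold stdGaussianDensity
  refine Integrable.const_mul ?_ _
  have h := (GaussianFourier.integrable_cexp_neg_mul_sq_norm_add (V := V) (b := 1 / 2)
    (by norm_num) 0 0).re
  refine h.congr (ae_of_all _ fun y => ?_)
  have : -(1 / 2 : ℂ) * ‖y‖ ^ 2 + 0 * ⟪(0 : V), y⟫ = ((-‖y‖ ^ 2 / 2 : ℝ) : ℂ) := by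
    push_cast; ring
  change (Complex.exp _).re = _
  rw [this, ← Complex.ofReal_exp, Complex.ofReal_re]

lemma stdGaussian_eq_withDensity :
    stdGaussian V = volume.withDensity fun y => ENNReal.ofReal (stdGaussianDensity V y) := by
  have hfin : IsFiniteMeasure
      ((volume : Measure V).withDensity fun y => ENNReal.ofReal (stdGaussianDensity V y)) :=
    isFiniteMeasure_withDensity_ofReal integrable_stdGaussianDensity.2
  refine Measure.ext_of_charFun (funext fun t => ?_)
  rw [charFun_stdGaussian, charFun_apply,
    integral_withDensity_eq_integral_toReal_smul
      (continuous_stdGaussianDensity.measurable.ennreal_ofReal) (by simp)]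
  have h := GaussianFourier.integral_cexp_neg_mul_sq_norm_add (V := V) (b := 1 / 2)
    (by norm_num) Complex.I t
  have e : ∀ y : V, (ENNReal.ofReal (stdGaussianDensity V y)).toReal •
      Complex.exp (⟪y, t⟫ * Complex.I) = (((2 * Real.pi) ^ (-(finrank ℝ V : ℝ) / 2) : ℝ) : ℂ) *
      Complex.exp (-(1 / 2 : ℂ) * ‖y‖ ^ 2 + Complex.I * ⟪t, y⟫) := by
    intro y
    rw [ENNReal.toReal_ofReal (stdGaussianDensity_pos y).le, Complex.exp_add, real_inner_comm y t,
      Complex.real_smul, stdGaussianDensity, Complex.ofReal_mul, Complex.ofReal_exp, mul_assoc]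
    congr 3
    · push_cast; ring_nf
    · ring_nf
  simp_rw [e]
  rw [integral_const_mul, h, ← mul_assoc]
  have hπ : (Real.pi / (1 / 2 : ℂ)) ^ (finrank ℝ V / 2 : ℂ) =
      (((2 * Real.pi) ^ ((finrank ℝ V : ℝ) / 2) : ℝ) : ℂ) := by
    rw [Complex.ofReal_cpow (by positivity)]
    push_cast
    congr 1
    ring
  rw [hπ, ← Complex.ofReal_mul, ← Real.rpow_add (by positivity)]
  have : -(finrank ℝ V : ℝ) / 2 + finrank ℝ V / 2 = 0 := by ring
  rw [this, Real.rpow_zero, Complex.ofReal_one, one_mul, Complex.I_sq]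
  congr 1
  ring

lemma integral_stdGaussian_eq {F : Type*} [NormedAddCommGroup F] [NormedSpace ℝ F] (f : V → F)
    (S : Set V) (hS : MeasurableSet S) :
    ∫ y in S, f y ∂(stdGaussian V) = ∫ y in S, stdGaussianDensity V y • f y := by
  rw [stdGaussian_eq_withDensity, restrict_withDensity hS,
    integral_withDensity_eq_integral_toReal_smul
      (continuous_stdGaussianDensity.measurable.ennreal_ofReal) (by simp)]
  refine integral_congr_ae (ae_of_all _ fun y => ?_)
  simp [ENNReal.toReal_ofReal (stdGaussianDensity_pos y).le]

lemma integrable_stdGaussian_iff {F : Type*} [NormedAddCommGroup F] [NormedSpace ℝ F] (f : V → F) :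
    Integrable f (stdGaussian V) ↔ Integrable fun y => stdGaussianDensity V y • f y := by
  rw [stdGaussian_eq_withDensity, integrable_withDensity_iff_integrable_smul'
      (continuous_stdGaussianDensity.measurable.ennreal_ofReal) (by simp)]
  simp [ENNReal.toReal_ofReal (stdGaussianDensity_pos _).le]

/-- Slicing of Lebesgue measure by the hyperplanes orthogonal to a unit vector `u`, along an
oblique direction `w` normalized by `⟪u, w⟫ = 1`. -/
lemma measurePreserving_slicing {u w : V} (hu : ‖u‖ = 1) (hw : ⟪u, w⟫ = 1) (c : ℝ) :
    MeasurePreserving (fun p : (ℝ ∙ u)ᗮ × ℝ => c • u + (p.1 : V) + p.2 • w)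
      (volume.prod volume) volume := by
  have h0 : MeasurePreserving (fun p : (ℝ ∙ u) × (ℝ ∙ u)ᗮ => (p.1 : V) + p.2)
      (volume.prod volume) volume := by
    have := ((ℝ ∙ u).measurePreserving_measurableEquivProd (0 : V)).symm
    rw [InnerProductSpace.euclideanHausdorffMeasure_eq_volume] at this
    have e : (fun p : (ℝ ∙ u) × (ℝ ∙ u)ᗮ => (p.1 : V) + p.2) =
        ((ℝ ∙ u).measurableEquivProd (0 : V)).symm := by
      ext p
      simp only [Submodule.measurableEquivProd_symm_apply, vadd_eq_add, add_zero]
    rw [e]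
    exact this
  have h1 : MeasurePreserving (fun r : ℝ => LinearIsometryEquiv.toSpanUnitSingleton (𝕜 := ℝ) u hu r)
      volume volume := LinearIsometryEquiv.measurePreserving _
  have h2 : MeasurePreserving (fun p : ℝ × (ℝ ∙ u)ᗮ => p.1 • u + (p.2 : V))
      (volume.prod volume) volume :=
    h0.comp (h1.prod (MeasurePreserving.id volume))
  have hw' : w - u ∈ (ℝ ∙ u)ᗮ := by
    rw [Submodule.mem_orthogonal_singleton_iff_inner_right, inner_sub_right, hw,
      real_inner_self_eq_norm_sq, hu]
    norm_num
  have h3 : MeasurePreserving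
      (fun p : ℝ × (ℝ ∙ u)ᗮ => (c + p.1, p.2 + p.1 • (⟨w - u, hw'⟩ : (ℝ ∙ u)ᗮ)))
      (volume.prod volume) (volume.prod volume) := by
    refine MeasurePreserving.skew_product (f := fun r => c + r)
      (g := fun r z => z + r • (⟨w - u, hw'⟩ : (ℝ ∙ u)ᗮ)) (measurePreserving_add_left _ c) ?_ ?_
    · exact (by fun_prop : Continuous fun p : ℝ × (ℝ ∙ u)ᗮ =>
        p.2 + p.1 • (⟨w - u, hw'⟩ : (ℝ ∙ u)ᗮ)).measurable
    · exact ae_of_all _ fun r => (measurePreserving_add_right _ _).map_eq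
  have h4 := (h2.comp h3).comp
    (Measure.measurePreserving_swap (μ := (volume : Measure (ℝ ∙ u)ᗮ)) (ν := (volume : Measure ℝ)))
  convert h4 using 1
  ext p
  simp only [Function.comp, Prod.fst_swap, Prod.snd_swap, Submodule.coe_add, Submodule.coe_smul]
  module

lemma map_orthogonal_eq_restrict {u : V} (hu : ‖u‖ = 1) (c : ℝ) :
    Measure.map (fun z : (ℝ ∙ u)ᗮ => c • u + (z : V)) volume =
      (μHE[finrank ℝ V - 1] : Measure V).restrict {y | ⟪u, y⟫ = c} := by
  have hiso : Isometry fun z : (ℝ ∙ u)ᗮ => c • u + (z : V) :=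
    Isometry.of_dist_eq fun a b => by rw [dist_add_left]; rfl
  have hfr : finrank ℝ V - 1 = finrank ℝ (ℝ ∙ u)ᗮ := by
    have h1 := (ℝ ∙ u).finrank_add_finrank_orthogonal
    rw [finrank_span_singleton (by rintro rfl; simp at hu)] at h1
    omega
  have hr : range (fun z : (ℝ ∙ u)ᗮ => c • u + (z : V)) = {y | ⟪u, y⟫ = c} := by
    ext y
    simp only [mem_range, mem_ofPred_eq]
    constructor
    · rintro ⟨z, rfl⟩
      rw [inner_add_right, inner_smul_right, real_inner_self_eq_norm_sq, hu,
        Submodule.mem_orthogonal_singleton_iff_inner_right.1 z.2]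
      simp
    · intro hy
      refine ⟨⟨y - c • u, ?_⟩, by simp⟩
      rw [Submodule.mem_orthogonal_singleton_iff_inner_right, inner_sub_right, inner_smul_right,
        real_inner_self_eq_norm_sq, hu, hy]
      simp
  rw [← InnerProductSpace.euclideanHausdorffMeasure_eq_volume (V := (ℝ ∙ u)ᗮ), ← hfr,
    hiso.map_euclideanHausdorffMeasure, hr]

lemma measurableEmbedding_add_orthogonal (u : V) (c : ℝ) :
    MeasurableEmbedding fun z : (ℝ ∙ u)ᗮ => c • u + (z : V) :=
  (measurableEmbedding_addLeft (c • u)).comp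
    (MeasurableEmbedding.subtype_coe (Submodule.closed_of_finiteDimensional _).measurableSet)

/-- The fundamental theorem of calculus on a half-space, cut by a cylinder `S` in an oblique
direction `w`: only the bounding hyperplane contributes to the integral of a derivative along `w`,
since `S` is a union of lines parallel to `w`. -/
theorem integral_halfSpace_fderiv {u w : V} (hu : ‖u‖ = 1) (hw : ⟪u, w⟫ = 1) (c : ℝ) {S : Set V}
    (hS : MeasurableSet S) (hSw : ∀ y (t : ℝ), y + t • w ∈ S ↔ y ∈ S) {F : V → ℝ}
    (hF : Differentiable ℝ F) (hint : Integrable fun y => fderiv ℝ F y w)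
    (hlim : ∀ y, Tendsto (fun t : ℝ => F (y + t • w)) atTop (𝓝 0)) :
    ∫ y in S ∩ {y | c < ⟪u, y⟫}, fderiv ℝ F y w =
      -∫ y in S ∩ {y | ⟪u, y⟫ = c}, F y ∂(μHE[finrank ℝ V - 1] : Measure V) := by
  have hmeas : MeasurableSet (S ∩ {y | c < ⟪u, y⟫}) :=
    hS.inter (measurableSet_lt measurable_const (by fun_prop))
  have hmp := measurePreserving_slicing hu hw c
  have key : ∀ (z : (ℝ ∙ u)ᗮ) (t : ℝ),
      c • u + (z : V) + t • w ∈ S ∩ {y | c < ⟪u, y⟫} ↔ c • u + (z : V) ∈ S ∧ 0 < t := by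
    intro z t
    rw [mem_inter_iff, hSw, mem_ofPred_eq, inner_add_right, inner_add_right, inner_smul_right,
      inner_smul_right, real_inner_self_eq_norm_sq, hu, hw,
      Submodule.mem_orthogonal_singleton_iff_inner_right.1 z.2]
    simp
  set G : V → ℝ := (S ∩ {y | c < ⟪u, y⟫}).indicator fun y => fderiv ℝ F y w with hG
  have hGint : Integrable G := hint.indicator hmeas
  have hG' : ∀ (z : (ℝ ∙ u)ᗮ), (fun t : ℝ => G (c • u + (z : V) + t • w)) =
      (S.indicator (fun _ => (1 : ℝ)) (c • u + (z : V))) •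
        (Ioi (0 : ℝ)).indicator fun t => fderiv ℝ F (c • u + (z : V) + t • w) w := by
    intro z
    ext t
    by_cases h1 : c • u + (z : V) ∈ S <;> by_cases h2 : 0 < t <;>
      simp [hG, indicator, key, h1, h2]
  rw [← integral_indicator hmeas, ← hmp.map_eq, integral_map hmp.measurable.aemeasurable
    (by rw [hmp.map_eq]; exact hGint.1)]
  have hcomp : Integrable (fun p : (ℝ ∙ u)ᗮ × ℝ => G (c • u + (p.1 : V) + p.2 • w))
      (volume.prod volume) := hmp.integrable_comp_of_integrable hGint
  rw [integral_prod _ hcomp]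
  have hae := hcomp.prod_right_ae
  have inner_eq : ∀ᵐ z : (ℝ ∙ u)ᗮ, ∫ t : ℝ, G (c • u + (z : V) + t • w) =
      -S.indicator F (c • u + (z : V)) := by
    filter_upwards [hae] with z hz
    have hz : Integrable (fun t : ℝ => G (c • u + (z : V) + t • w)) := hz
    rw [hG' z] at hz ⊢
    by_cases h1 : c • u + (z : V) ∈ S
    · simp only [h1, indicator_of_mem, one_smul] at hz ⊢
      rw [integral_indicator measurableSet_Ioi]
      rw [integrable_indicator_iff measurableSet_Ioi] at hz
      rw [integral_Ioi_of_hasDerivAt_of_tendsto' (f := fun t => F (c • u + (z : V) + t • w))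
        (m := 0) ?_ hz (hlim _)]
      · simp
      · intro t _
        have h : HasDerivAt (fun t : ℝ => c • u + (z : V) + t • w) w t := by
          simpa using ((hasDerivAt_id t).smul_const w).const_add (c • u + (z : V))
        exact (hF _).hasFDerivAt.comp_hasDerivAt t h
    · simp [h1]
  rw [integral_congr_ae inner_eq, integral_neg, ← Measure.restrict_restrict hS,
    ← map_orthogonal_eq_restrict hu, ← integral_indicator hS,
    (measurableEmbedding_add_orthogonal u c).integral_map]

end Measure

/-! ### Gaussian integration by parts on half-spaces -/

section Gaussian

variable {V : Type*} [NormedAddCommGroup V] [InnerProductSpace ℝ V] [FiniteDimensional ℝ V]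
  [MeasurableSpace V] [BorelSpace V]

omit [FiniteDimensional ℝ V] [MeasurableSpace V] [BorelSpace V] in
lemma hasFDerivAt_neg_norm_sq_div_two (y : V) :
    HasFDerivAt (fun y : V => -‖y‖ ^ 2 / 2) (-innerSL ℝ y) y := by
  have h := ((hasStrictFDerivAt_norm_sq y).hasFDerivAt).const_mul (-1 / 2 : ℝ)
  refine (h.congr_fderiv ?_).congr_of_eventuallyEq (Eventually.of_forall fun z => ?_)
  · ext v
    simp only [_root_.smul_apply, _root_.neg_apply, smul_eq_mul,
      nsmul_eq_mul, Nat.cast_ofNat]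
    ring
  · change -‖z‖ ^ 2 / 2 = -1 / 2 * ‖z‖ ^ 2
    ring

omit [FiniteDimensional ℝ V] [MeasurableSpace V] [BorelSpace V] in
lemma hasFDerivAt_stdGaussianDensity (y : V) :
    HasFDerivAt (stdGaussianDensity V) (-stdGaussianDensity V y • innerSL ℝ y) y := by
  have h1 := hasFDerivAt_neg_norm_sq_div_two y
  have h2 := h1.exp.const_mul ((2 * Real.pi) ^ (-(finrank ℝ V : ℝ) / 2))
  refine h2.congr_fderiv ?_
  ext v
  simp only [stdGaussianDensity, _root_.smul_apply, _root_.neg_apply,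
    smul_eq_mul]
  ring

lemma integrable_norm_stdGaussian : Integrable (fun y : V => ‖y‖) (stdGaussian V) :=
  IsGaussian.integrable_id.norm

lemma integrable_fderiv_sub_inner_mul {f : V → ℝ} (hf : Differentiable ℝ f) {C : ℝ}
    (hC : ∀ y, |f y| ≤ C) (hC' : ∀ y, ‖fderiv ℝ f y‖ ≤ C) (w : V) :
    Integrable (fun y => fderiv ℝ f y w - ⟪y, w⟫ * f y) (stdGaussian V) := by
  refine Integrable.mono' (g := fun y => C * ‖w‖ + (C * ‖w‖) * ‖y‖)
    ((integrable_const _).add (integrable_norm_stdGaussian.const_mul _)) ?_ (ae_of_all _ fun y => ?_)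
  · have h1 : Measurable fun y => fderiv ℝ f y w := measurable_fderiv_apply_const ℝ f w
    have h2 := hf.continuous.measurable
    have h3 : Measurable fun y : V => ⟪y, w⟫ := by fun_prop
    exact (h1.sub (h3.mul h2)).aestronglyMeasurable
  · have h1 : ‖fderiv ℝ f y w‖ ≤ C * ‖w‖ :=
      ((fderiv ℝ f y).le_opNorm w).trans (by gcongr; exact hC' y)
    have h2 : ‖⟪y, w⟫ * f y‖ ≤ ‖y‖ * ‖w‖ * C := by
      rw [norm_mul]
      gcongr
      · exact norm_inner_le_norm y w
      · exact hC y
    calc _ ≤ ‖fderiv ℝ f y w‖ + ‖⟪y, w⟫ * f y‖ := norm_sub_le _ _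
      _ ≤ _ := by linarith

/-- Gaussian integration by parts on a half-space cut by a cylinder parallel to `w`. -/
theorem integral_halfSpace_stdGaussian {u w : V} (hu : ‖u‖ = 1) (hw : ⟪u, w⟫ = 1) (c : ℝ)
    {S : Set V} (hS : MeasurableSet S) (hSw : ∀ y (t : ℝ), y + t • w ∈ S ↔ y ∈ S) {f : V → ℝ}
    (hf : Differentiable ℝ f) {C : ℝ} (hC : ∀ y, |f y| ≤ C) (hC' : ∀ y, ‖fderiv ℝ f y‖ ≤ C) :
    ∫ y in S ∩ {y | c < ⟪u, y⟫}, (fderiv ℝ f y w - ⟪y, w⟫ * f y) ∂(stdGaussian V) =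
      -∫ y in S ∩ {y | ⟪u, y⟫ = c}, stdGaussianDensity V y * f y
        ∂(μHE[finrank ℝ V - 1] : Measure V) := by
  have hder : ∀ y, fderiv ℝ (fun y => stdGaussianDensity V y * f y) y w =
      stdGaussianDensity V y • (fderiv ℝ f y w - ⟪y, w⟫ * f y) := by
    intro y
    rw [((hasFDerivAt_stdGaussianDensity y).fun_mul (hf y).hasFDerivAt).fderiv]
    simp only [_root_.add_apply, _root_.smul_apply, smul_eq_mul,
      innerSL_apply_apply]
    ring
  have hmeas : MeasurableSet (S ∩ {y | c < ⟪u, y⟫}) :=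
    hS.inter (measurableSet_lt measurable_const (by fun_prop))
  rw [integral_stdGaussian_eq _ _ hmeas, ← integral_halfSpace_fderiv hu hw c hS hSw]
  · simp_rw [hder]
  · exact fun y => ((hasFDerivAt_stdGaussianDensity y).fun_mul (hf y).hasFDerivAt).differentiableAt
  · simp_rw [hder]
    exact (integrable_stdGaussian_iff _).1 (integrable_fderiv_sub_inner_mul hf hC hC' w)
  · intro y
    have h1 : Tendsto (fun t : ℝ => ‖y + t • w‖) atTop atTop := by
      refine tendsto_atTop_mono (f := fun t => ⟪u, y⟫ + t) (fun t => ?_)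
        (tendsto_atTop_add_const_left _ _ tendsto_id)
      calc ⟪u, y⟫ + t = ⟪u, y + t • w⟫ := by rw [inner_add_right, inner_smul_right, hw, mul_one]
        _ ≤ ‖u‖ * ‖y + t • w‖ := real_inner_le_norm _ _
        _ = _ := by rw [hu, one_mul]
    have h2 : Tendsto (fun t : ℝ => stdGaussianDensity V (y + t • w)) atTop (𝓝 0) := by
      have h3 : Tendsto (fun r : ℝ => (2 * Real.pi) ^ (-(finrank ℝ V : ℝ) / 2) *
          Real.exp (-r ^ 2 / 2)) atTop (𝓝 0) := by
        rw [← mul_zero ((2 * Real.pi) ^ (-(finrank ℝ V : ℝ) / 2))]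
        refine (Real.tendsto_exp_atBot.comp ?_).const_mul _
        exact (tendsto_neg_atTop_atBot.comp (tendsto_pow_atTop two_ne_zero)).atBot_div_const
          two_pos
      exact h3.comp h1
    refine squeeze_zero_norm (a := fun t => stdGaussianDensity V (y + t • w) * C)
      (fun t => ?_) (by simpa using h2.mul_const C)
    rw [norm_mul, Real.norm_of_nonneg (stdGaussianDensity_pos _).le]
    exact mul_le_mul_of_nonneg_left (hC _) (stdGaussianDensity_pos _).le

lemma integrable_stdGaussianDensity_hyperplane {u : V} (hu : ‖u‖ = 1) (c : ℝ) :
    Integrable (stdGaussianDensity V)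
      ((μHE[finrank ℝ V - 1] : Measure V).restrict {y | ⟪u, y⟫ = c}) := by
  rw [← map_orthogonal_eq_restrict hu,
    (measurableEmbedding_add_orthogonal u c).integrable_map_iff]
  have h := (integrable_stdGaussianDensity (V := (ℝ ∙ u)ᗮ)).const_mul
    (stdGaussianDensity V (c • u) / (2 * Real.pi) ^ (-(finrank ℝ (ℝ ∙ u)ᗮ : ℝ) / 2))
  refine h.congr (ae_of_all _ fun z => ?_)
  have hz : ⟪c • u, (z : V)⟫ = 0 := by
    rw [inner_smul_left, Submodule.mem_orthogonal_singleton_iff_inner_right.1 z.2, mul_zero]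
  have hn : ‖c • u + (z : V)‖ ^ 2 = ‖c • u‖ ^ 2 + ‖z‖ ^ 2 := by
    rw [sq, norm_add_sq_eq_norm_sq_add_norm_sq_real hz, sq, sq, Submodule.coe_norm]
  have hp : ((2 * Real.pi) ^ (-(finrank ℝ (ℝ ∙ u)ᗮ : ℝ) / 2)) ≠ 0 := by positivity
  simp only [Function.comp, stdGaussianDensity]
  rw [hn, show -(‖c • u‖ ^ 2 + ‖z‖ ^ 2) / 2 = -‖c • u‖ ^ 2 / 2 + -‖z‖ ^ 2 / 2 by ring, Real.exp_add]
  field_simp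

/-- Translating a set changes its Gaussian integral by the Cameron–Martin density. -/
lemma setIntegral_add_image_stdGaussian {F : Type*} [NormedAddCommGroup F] [NormedSpace ℝ F]
    (x : V) {S : Set V} (hS : MeasurableSet S) (f : V → F) :
    ∫ y in (fun y => x + y) '' S, f y ∂(stdGaussian V) =
      ∫ y in S, Real.exp (⟪-x, y⟫ - ‖x‖ ^ 2 / 2) • f (x + y) ∂(stdGaussian V) := by
  have hemb := (MeasurableEquiv.addLeft x).measurableEmbedding
  have hS' : MeasurableSet ((fun y => x + y) '' S) := hemb.measurableSet_image.2 hS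
  rw [integral_stdGaussian_eq _ _ hS', integral_stdGaussian_eq _ _ hS,
    (measurePreserving_add_left volume x).setIntegral_image_emb hemb]
  refine setIntegral_congr_fun hS fun y _ => ?_
  simp only [smul_smul, stdGaussianDensity]
  rw [mul_assoc, ← Real.exp_add, norm_add_sq_real, inner_neg_left]
  congr 3
  ring

lemma integrable_exp_norm_stdGaussian (a : ℝ) :
    Integrable (fun y : V => Real.exp (a * ‖y‖)) (stdGaussian V) := by
  obtain ⟨C, hC, hint⟩ := IsGaussian.exists_integrable_exp_sq (stdGaussian V)
  refine Integrable.mono' (hint.const_mul (Real.exp (a ^ 2 / (4 * C)))) (by fun_prop)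
    (ae_of_all _ fun y => ?_)
  rw [Real.norm_of_nonneg (Real.exp_pos _).le, ← Real.exp_add, Real.exp_le_exp]
  have : 0 ≤ C * (‖y‖ - a / (2 * C)) ^ 2 := by positivity
  have e : C * (‖y‖ - a / (2 * C)) ^ 2 = C * ‖y‖ ^ 2 - a * ‖y‖ + a ^ 2 / (4 * C) := by
    field_simp
    ring
  linarith

end Gaussian

/-! ### Smoothness of Laplace transforms -/

section Laplace

universe u

variable {V F : Type u} [NormedAddCommGroup V] [InnerProductSpace ℝ V] [FiniteDimensional ℝ V]
  [MeasurableSpace V] [BorelSpace V] [NormedAddCommGroup F] [NormedSpace ℝ F]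

omit [FiniteDimensional ℝ V] in
lemma aestronglyMeasurable_innerSL_smulRight [SecondCountableTopology V] {μ : Measure V} {g : V → F}
    (hg : AEStronglyMeasurable g μ) :
    AEStronglyMeasurable (fun y => (innerSL ℝ y).smulRight (g y)) μ := by
  have h : Continuous fun p : V × F => (innerSL ℝ p.1).smulRight p.2 :=
    (isBoundedBilinearMap_smulRight (𝕜 := ℝ) (E := V) (F := F)).continuous.comp
      (((innerSL ℝ).continuous.comp continuous_fst).prodMk continuous_snd)
  exact h.comp_aestronglyMeasurable ((continuous_id.aestronglyMeasurable (μ := μ)).prodMk hg)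

lemma hasFDerivAt_integral_exp_inner {μ : Measure V} {g : V → F}
    (hg : AEStronglyMeasurable g μ)
    (hint : ∀ a : ℝ, Integrable (fun y => Real.exp (a * ‖y‖) * ‖g y‖) μ) (x : V) :
    HasFDerivAt (fun x : V => ∫ y, Real.exp ⟪x, y⟫ • g y ∂μ)
      (∫ y, Real.exp ⟪x, y⟫ • (innerSL ℝ y).smulRight (g y) ∂μ) x := by
  have hmeas : ∀ x : V, AEStronglyMeasurable (fun y => Real.exp ⟪x, y⟫ • g y) μ := fun x =>
    (by fun_prop : Continuous fun y : V => Real.exp ⟪x, y⟫).aestronglyMeasurable.smul hg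
  have hexp : ∀ x y : V, Real.exp ⟪x, y⟫ ≤ Real.exp (‖x‖ * ‖y‖) := fun x y =>
    Real.exp_le_exp.2 (real_inner_le_norm x y)
  refine hasFDerivAt_integral_of_dominated_of_fderiv_le
    (s := Metric.ball x 1) (bound := fun y => Real.exp ((‖x‖ + 2) * ‖y‖) * ‖g y‖)
    (F' := fun x y => Real.exp ⟪x, y⟫ • (innerSL ℝ y).smulRight (g y))
    (Metric.ball_mem_nhds x one_pos) (Eventually.of_forall hmeas) ?_ ?_ ?_ (hint _) ?_
  · refine (hint ‖x‖).mono' (hmeas x) (ae_of_all _ fun y => ?_)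
    rw [norm_smul, Real.norm_of_nonneg (Real.exp_pos _).le]
    exact mul_le_mul_of_nonneg_right (hexp x y) (norm_nonneg _)
  · refine (by fun_prop : Continuous fun y : V => Real.exp ⟪x, y⟫).aestronglyMeasurable.smul
      (aestronglyMeasurable_innerSL_smulRight hg)
  · refine ae_of_all _ fun y z hz => ?_
    have hz' : ‖z‖ ≤ ‖x‖ + 1 := by
      have := norm_sub_norm_le z x
      rw [mem_ball_iff_norm] at hz
      linarith
    rw [norm_smul, Real.norm_of_nonneg (Real.exp_pos _).le, ContinuousLinearMap.norm_smulRight_apply,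
      innerSL_apply_norm, ← mul_assoc]
    refine mul_le_mul_of_nonneg_right ?_ (norm_nonneg _)
    calc Real.exp ⟪z, y⟫ * ‖y‖ ≤ Real.exp (‖z‖ * ‖y‖) * Real.exp ‖y‖ := by
          gcongr
          · exact real_inner_le_norm z y
          · linarith [Real.add_one_le_exp ‖y‖]
      _ ≤ Real.exp ((‖x‖ + 2) * ‖y‖) := by
          rw [← Real.exp_add, Real.exp_le_exp]
          nlinarith [norm_nonneg y]
  · refine ae_of_all _ fun y z _ => ?_
    have h1 : HasFDerivAt (fun z : V => ⟪z, y⟫) (innerSL ℝ y) z := by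
      have := (innerSL ℝ y).hasFDerivAt (x := z)
      refine this.congr_of_eventuallyEq (Eventually.of_forall fun z => ?_)
      simp [real_inner_comm]
    refine (h1.exp.smul_const (g y)).congr_fderiv ?_
    ext v
    simp [mul_smul]

lemma contDiff_integral_exp_inner {μ : Measure V} (n : ℕ) {g : V → F}
    (hg : AEStronglyMeasurable g μ)
    (hint : ∀ a : ℝ, Integrable (fun y => Real.exp (a * ‖y‖) * ‖g y‖) μ) :
    ContDiff ℝ n (fun x : V => ∫ y, Real.exp ⟪x, y⟫ • g y ∂μ) := by
  induction n generalizing F with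
  | zero =>
    exact contDiff_zero.2 <| continuous_iff_continuousAt.2 fun x =>
      (hasFDerivAt_integral_exp_inner hg hint x).continuousAt
  | succ n ih =>
    push_cast
    rw [contDiff_succ_iff_hasFDerivAt]
    have hg' := aestronglyMeasurable_innerSL_smulRight hg
    refine ⟨_, ih hg' fun a => ?_, hasFDerivAt_integral_exp_inner hg hint⟩
    refine (hint (a + 1)).mono' ?_ (ae_of_all _ fun y => ?_)
    · exact (by fun_prop : Continuous fun y : V => Real.exp (a * ‖y‖)).aestronglyMeasurable.mul
        hg'.norm
    · rw [ContinuousLinearMap.norm_smulRight_apply, innerSL_apply_norm, norm_mul,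
        Real.norm_of_nonneg (Real.exp_pos _).le, norm_mul, norm_norm, norm_norm, ← mul_assoc]
      refine mul_le_mul_of_nonneg_right ?_ (norm_nonneg _)
      rw [add_mul, Real.exp_add, one_mul]
      gcongr
      linarith [Real.add_one_le_exp ‖y‖]

end Laplace

/-! ### Coordinates on `E` -/

section Coordinates

variable {q : ℕ}

lemma sum_coord_eq_zero (y : E q) : ∑ i, y.1 i = 0 := y.2

lemma inner_edge (i j : Fin q) (y : E q) : ⟪edge q i j, y⟫ = y.1 i - y.1 j := by
  rw [Submodule.coe_inner]
  simp [edge, inner_sub_left, EuclideanSpace.inner_single_left]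

@[fun_prop]
lemma continuous_coord (i : Fin q) : Continuous fun y : E q => y.1 i := by
  fun_prop

lemma E_eq_orthogonal : E q = (ℝ ∙ (WithLp.toLp 2 fun _ : Fin q => (1 : ℝ)))ᗮ := by
  ext y
  rw [Submodule.mem_orthogonal_singleton_iff_inner_right]
  simp [PiLp.inner_apply, E]

lemma finrank_E (hq : 1 ≤ q) : finrank ℝ (E q) = q - 1 := by
  have hne : (WithLp.toLp 2 fun _ : Fin q => (1 : ℝ)) ≠ 0 := by
    intro h
    have := congrArg (fun v : EuclideanSpace ℝ (Fin q) => v ⟨0, hq⟩) h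
    simp at this
  have h := (ℝ ∙ (WithLp.toLp 2 fun _ : Fin q => (1 : ℝ))).finrank_add_finrank_orthogonal
  rw [finrank_span_singleton hne, ← E_eq_orthogonal, finrank_euclideanSpace_fin] at h
  have h' : 1 + finrank ℝ (E q) = q := h
  omega

lemma gaussDensity_eq (hq : 1 ≤ q) : gaussDensity q = stdGaussianDensity (E q) := by
  ext y
  rw [gaussDensity, stdGaussianDensity, finrank_E hq, Nat.cast_sub hq]
  simp

/-- The unit vector `(e_i - e_j) / √2`, normal to the interface between the cells `i` and `j`. -/
noncomputable def unitEdge (q : ℕ) (i j : Fin q) : E q := (1 / √2 : ℝ) • edge q i j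

lemma inner_unitEdge (i j : Fin q) (y : E q) :
    ⟪unitEdge q i j, y⟫ = (1 / √2) * (y.1 i - y.1 j) := by
  rw [unitEdge, real_inner_smul_left (edge q i j) y, inner_edge]

lemma coord_unitEdge (i j k : Fin q) : (unitEdge q i j).1 k =
    (1 / √2) * ((if k = i then 1 else 0) - (if k = j then 1 else 0)) := by
  simp [unitEdge, edge]

lemma norm_unitEdge {i j : Fin q} (hij : i ≠ j) : ‖unitEdge q i j‖ = 1 := by
  have h : ‖unitEdge q i j‖ ^ 2 = 1 := by
    rw [← real_inner_self_eq_norm_sq, inner_unitEdge, coord_unitEdge, coord_unitEdge]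
    have h2 : (√2 : ℝ) ^ 2 = 2 := Real.sq_sqrt (by norm_num)
    simp only [if_true, hij, hij.symm, if_false]
    field_simp
    rw [h2]; norm_num
  nlinarith [norm_nonneg (unitEdge q i j)]

/-- The vectors `(1/q) ∑_k e_k - e_j`. For a fixed `i`, those with `j ≠ i` form the basis of `E`
dual to the functionals `y ↦ y_i - y_j`. Moving along `dualVec q j` changes `y_i - y_j` and leaves
every `y_i - y_k`, `k ≠ j`, fixed, so that it moves only one facet of the `i`-th cell. -/
noncomputable def dualVec (q : ℕ) (j : Fin q) : E q :=
  ⟨WithLp.toLp 2 fun k => (1 / q : ℝ) - if k = j then 1 else 0, by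
    have hq : (q : ℝ) ≠ 0 := by
      have := j.pos
      positivity
    change ∑ k, ((1 / q : ℝ) - if k = j then 1 else 0) = 0
    simp [hq]⟩

lemma coord_dualVec (j k : Fin q) :
    (dualVec q j).1 k = (1 / q : ℝ) - if k = j then 1 else 0 := rfl

lemma sum_smul_dualVec (i : Fin q) (y : E q) : ∑ j, (y.1 i - y.1 j) • dualVec q j = y := by
  have hq : (q : ℝ) ≠ 0 := by
    have := i.pos
    positivity
  ext k
  have h : (∑ j, (y.1 i - y.1 j) • dualVec q j).1 k =
      ∑ j, (y.1 i - y.1 j) * ((1 / q : ℝ) - if k = j then 1 else 0) := by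
    simp [coord_dualVec]
  rw [h]
  simp only [mul_sub, Finset.sum_sub_distrib, ← Finset.sum_mul, sum_coord_eq_zero]
  simp
  field_simp
  ring

lemma trace_eq_sum_edge (i : Fin q) (T : E q →ₗ[ℝ] E q) :
    LinearMap.trace ℝ (E q) T = ∑ j, ⟪edge q i j, T (dualVec q j)⟫ := by
  have h : T = ∑ j, (innerSL ℝ (edge q i j) : E q →ₗ[ℝ] ℝ).smulRight (T (dualVec q j)) := by
    ext1 y
    conv_lhs => rw [← sum_smul_dualVec i y]
    rw [map_sum, LinearMap.sum_apply]
    refine Finset.sum_congr rfl fun j _ => ?_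
    rw [map_smul, ← inner_edge]
    rfl
  conv_lhs => rw [h]
  rw [map_sum]
  exact Finset.sum_congr rfl fun j _ => LinearMap.trace_smulRight _ _

end Coordinates

/-! ### Cells, interfaces and facets -/

section Cells

variable {q : ℕ}

lemma modelCell_eq (i : Fin q) : modelCell q i = {y | ∀ j, j ≠ i → y.1 j < y.1 i} := by
  refine subset_antisymm (fun y hy j hj => ?_) (interior_maximal (fun y hy j => ?_) ?_)
  · have hlim : Tendsto (fun t : ℝ => y + t • edge q j i) (𝓝[>] 0) (𝓝 y) := by
      have : Continuous fun t : ℝ => y + t • edge q j i := by fun_prop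
      simpa using this.tendsto' 0 _ (by simp) |>.mono_left nhdsWithin_le_nhds
    obtain ⟨t, ht, ht0⟩ := ((hlim.eventually (mem_interior_iff_mem_nhds.1 hy)).and
      self_mem_nhdsWithin).exists
    have := ht j
    have ht0 : 0 < t := ht0
    simp [edge, hj, hj.symm] at this
    linarith
  · rcases eq_or_ne j i with rfl | h
    · exact le_rfl
    · exact (hy j h).le
  · simp only [ofPred_forall]
    exact isOpen_iInter_of_finite fun j => isOpen_iInter_of_finite fun _ =>
      isOpen_lt (continuous_coord j) (continuous_coord i)

lemma closure_modelCell (i : Fin q) : closure (modelCell q i) = {y | ∀ j, y.1 j ≤ y.1 i} := by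
  refine subset_antisymm (closure_minimal interior_subset ?_) fun y hy => ?_
  · simp only [ofPred_forall]
    exact isClosed_iInter fun j => isClosed_le (continuous_coord j) (continuous_coord i)
  · have hlim : Tendsto (fun t : ℝ => y - t • dualVec q i) (𝓝[>] 0) (𝓝 y) := by
      have : Continuous fun t : ℝ => y - t • dualVec q i := by fun_prop
      simpa using this.tendsto' 0 _ (by simp) |>.mono_left nhdsWithin_le_nhds
    refine mem_closure_of_tendsto hlim ?_
    filter_upwards [self_mem_nhdsWithin] with t ht
    have ht : 0 < t := ht
    rw [modelCell_eq]
    intro j hj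
    have := hy j
    simp [coord_dualVec, hj]
    linarith

lemma modelInterface_eq {i j : Fin q} (hij : i ≠ j) :
    modelInterface q i j = {y | y.1 i = y.1 j ∧ ∀ k, y.1 k ≤ y.1 i} := by
  have hopen : ∀ i, IsOpen (modelCell q i) := fun i => isOpen_interior
  ext y
  simp only [modelInterface, (hopen _).frontier_eq, closure_modelCell, mem_inter_iff,
    Set.mem_sdiff, mem_ofPred_eq]
  rw [modelCell_eq, modelCell_eq]
  constructor
  · rintro ⟨⟨h1, -⟩, h2, -⟩
    exact ⟨le_antisymm (h2 i) (h1 j), h1⟩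
  · rintro ⟨h1, h2⟩
    refine ⟨⟨h2, fun h => ?_⟩, fun k => h1 ▸ h2 k, fun h => ?_⟩
    · exact (h j hij.symm).ne h1.symm
    · exact (h i hij).ne h1

lemma modelInterface_comm (i j : Fin q) : modelInterface q i j = modelInterface q j i :=
  inter_comm _ _

lemma mem_shift_iff {x y : E q} {S : Set (E q)} : y ∈ shift x S ↔ y - x ∈ S := by
  rw [shift, mem_image]
  constructor
  · rintro ⟨z, hz, rfl⟩
    simpa using hz
  · exact fun h => ⟨_, h, by simp⟩

lemma shift_modelCell (x : E q) (i : Fin q) :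
    shift x (modelCell q i) = {y | ∀ j, j ≠ i → x.1 i - x.1 j < y.1 i - y.1 j} := by
  ext y
  rw [mem_shift_iff, modelCell_eq]
  refine forall₂_congr fun j _ => ?_
  simp only [Submodule.coe_sub, PiLp.sub_apply]
  constructor <;> intro h <;> linarith

lemma isOpen_shift_modelCell (x : E q) (i : Fin q) : IsOpen (shift x (modelCell q i)) :=
  (Homeomorph.addLeft x).isOpenMap _ isOpen_interior

lemma shift_modelInterface (x : E q) {i j : Fin q} (hij : i ≠ j) :
    shift x (modelInterface q i j) =
      {y | y.1 i - y.1 j = x.1 i - x.1 j ∧ ∀ k, x.1 i - x.1 k ≤ y.1 i - y.1 k} := by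
  ext y
  rw [mem_shift_iff, modelInterface_eq hij]
  simp only [Submodule.coe_sub, PiLp.sub_apply, mem_ofPred_eq]
  refine and_congr ?_ (forall_congr' fun k => ?_)
  · constructor <;> intro h <;> linarith
  · constructor <;> intro h <;> linarith

/-- The cylinder cut out by the facets of the `i`-th translated cell other than the `j`-th one. -/
def facetCylinder (x : E q) (i j : Fin q) : Set (E q) :=
  {y | ∀ k, k ≠ i → k ≠ j → x.1 i - x.1 k < y.1 i - y.1 k}

lemma isOpen_facetCylinder (x : E q) (i j : Fin q) : IsOpen (facetCylinder x i j) := by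
  simp only [facetCylinder, ofPred_forall]
  exact isOpen_iInter_of_finite fun k => isOpen_iInter_of_finite fun _ =>
    isOpen_iInter_of_finite fun _ => isOpen_lt (by fun_prop) (by fun_prop)

lemma add_smul_dualVec_mem_facetCylinder (x : E q) {i j : Fin q} (hij : i ≠ j) (y : E q) (t : ℝ) :
    y + t • dualVec q j ∈ facetCylinder x i j ↔ y ∈ facetCylinder x i j := by
  refine forall₃_congr fun k _ hkj => ?_
  simp only [Submodule.coe_add, Submodule.coe_smul, PiLp.add_apply, PiLp.smul_apply, coord_dualVec,
    hkj, hij, if_false, smul_eq_mul]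
  constructor <;> intro h <;> linarith

lemma shift_modelCell_eq_inter (x : E q) {i j : Fin q} (hij : i ≠ j) :
    shift x (modelCell q i) = facetCylinder x i j ∩
      {y | (1 / √2) * (x.1 i - x.1 j) < ⟪unitEdge q i j, y⟫} := by
  have h2 : (0 : ℝ) < 1 / √2 := by positivity
  ext y
  rw [shift_modelCell, mem_inter_iff, mem_ofPred_eq, mem_ofPred_eq, inner_unitEdge,
    mul_lt_mul_iff_right₀ h2]
  constructor
  · exact fun h => ⟨fun k hk _ => h k hk, h j hij.symm⟩
  · rintro ⟨h1, h3⟩ k hk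
    rcases eq_or_ne k j with rfl | hkj
    · exact h3
    · exact h1 k hk hkj

/-- The relative interior of the translated interface between the cells `i` and `j`. -/
def openFacet (x : E q) (i j : Fin q) : Set (E q) :=
  facetCylinder x i j ∩ {y | ⟪unitEdge q i j, y⟫ = (1 / √2) * (x.1 i - x.1 j)}

lemma volume_level_set_eq_zero {V : Type*} [NormedAddCommGroup V] [InnerProductSpace ℝ V]
    [FiniteDimensional ℝ V] [MeasurableSpace V] [BorelSpace V] {f : V →ₗ[ℝ] ℝ} (hf : f ≠ 0)
    (d : ℝ) : volume {y | f y = d} = 0 := by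
  rcases eq_empty_or_nonempty {y | f y = d} with h | ⟨y₀, hy₀⟩
  · rw [h, measure_empty]
  · have h : {y | f y = d} = (fun y => y + -y₀) ⁻¹' (LinearMap.ker f : Set V) := by
      ext y
      simp only [mem_ofPred_eq, mem_preimage, SetLike.mem_coe, LinearMap.mem_ker, map_add, map_neg]
      rw [show f y₀ = d from hy₀]
      constructor <;> intro h <;> linarith
    rw [h, measure_preimage_add_right]
    exact Measure.addHaar_submodule _ _ fun h => hf (LinearMap.ker_eq_top.1 h)

lemma measure_level_inter_hyperplane {i j k : Fin q} (hki : k ≠ i) (hkj : k ≠ j) (hij : i ≠ j)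
    (c d : ℝ) : (μHE[finrank ℝ (E q) - 1] : Measure (E q)).restrict
      {y | ⟪unitEdge q i j, y⟫ = c} {y | y.1 i - y.1 k = d} = 0 := by
  rw [← map_orthogonal_eq_restrict (norm_unitEdge hij),
    (measurableEmbedding_add_orthogonal _ _).map_apply]
  have hv : edge q i k + edge q j k ∈ (ℝ ∙ unitEdge q i j)ᗮ := by
    rw [Submodule.mem_orthogonal_singleton_iff_inner_right, inner_unitEdge]
    simp [edge, hij, hij.symm, hki, hkj]
  let f : (ℝ ∙ unitEdge q i j)ᗮ →ₗ[ℝ] ℝ :=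
    (innerSL ℝ (edge q i k)).toLinearMap ∘ₗ (ℝ ∙ unitEdge q i j)ᗮ.subtype
  have hf : f ≠ 0 := by
    intro h
    have h1 := LinearMap.congr_fun h ⟨_, hv⟩
    simp only [f, LinearMap.comp_apply, Submodule.subtype_apply, LinearMap.zero_apply] at h1
    change ⟪edge q i k, edge q i k + edge q j k⟫ = 0 at h1
    rw [inner_edge] at h1
    simp [edge, hij, hki, hkj, hki.symm] at h1
    norm_num at h1
  have h := volume_level_set_eq_zero (V := ↥(ℝ ∙ unitEdge q i j)ᗮ) hf
    (d - ⟪edge q i k, c • unitEdge q i j⟫)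
  convert h using 2
  ext z
  simp only [mem_preimage, mem_ofPred_eq, f, LinearMap.comp_apply, Submodule.subtype_apply]
  rw [← inner_edge, inner_add_right]
  change _ ↔ ⟪edge q i k, (z : E q)⟫ = _
  constructor <;> intro h <;> linarith

end Cells

/-! ### The Gauss–Green formula for a cell -/

section GaussGreen

variable {q : ℕ}

lemma finrank_E_sub_one (hq : 1 ≤ q) : finrank ℝ (E q) - 1 = q - 2 := by
  rw [finrank_E hq]; omega

lemma gaussSurface_eq (hq : 1 ≤ q) : gaussSurface q =
    (μHE[finrank ℝ (E q) - 1] : Measure (E q)).withDensity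
      fun y => ENNReal.ofReal (stdGaussianDensity (E q) y) := by
  rw [gaussSurface, finrank_E_sub_one hq, gaussDensity_eq hq]

lemma measurableSet_openFacet (x : E q) (i j : Fin q) : MeasurableSet (openFacet x i j) :=
  (isOpen_facetCylinder x i j).measurableSet.inter
    (measurableSet_eq_fun (by fun_prop) measurable_const)

lemma openFacet_subset_shift_modelInterface (x : E q) {i j : Fin q} (hij : i ≠ j) :
    openFacet x i j ⊆ shift x (modelInterface q i j) := by
  rintro y ⟨hy, hy'⟩
  rw [mem_ofPred_eq, inner_unitEdge] at hy'
  have h : y.1 i - y.1 j = x.1 i - x.1 j := mul_left_cancel₀ (by positivity) hy'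
  rw [shift_modelInterface x hij]
  refine ⟨h, fun k => ?_⟩
  rcases eq_or_ne k i with rfl | hki
  · simp
  rcases eq_or_ne k j with rfl | hkj
  · exact h.ge
  · exact (hy k hki hkj).le

/-- An interface and its relative interior differ by subsets of codimension two. -/
lemma openFacet_ae_eq (x : E q) {i j : Fin q} (hij : i ≠ j) :
    openFacet x i j =ᵐ[gaussSurface q] shift x (modelInterface q i j) := by
  rw [gaussSurface_eq i.pos]
  refine (withDensity_absolutelyContinuous _ _).ae_eq ?_
  refine (openFacet_subset_shift_modelInterface x hij).eventuallyLE.antisymm ?_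
  rw [ae_le_set]
  have hsub : shift x (modelInterface q i j) \ openFacet x i j ⊆
      ⋃ (k : Fin q) (_ : k ≠ i ∧ k ≠ j), {y | y.1 i - y.1 k = x.1 i - x.1 k} ∩
        {y | ⟪unitEdge q i j, y⟫ = (1 / √2) * (x.1 i - x.1 j)} := by
    rintro y ⟨hy, hy'⟩
    rw [shift_modelInterface x hij] at hy
    have h : ⟪unitEdge q i j, y⟫ = (1 / √2) * (x.1 i - x.1 j) := by rw [inner_unitEdge, hy.1]
    have hcyl : y ∉ facetCylinder x i j := fun hc => hy' ⟨hc, h⟩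
    simp only [facetCylinder, mem_ofPred_eq, not_forall, not_lt] at hcyl
    obtain ⟨k, hki, hkj, hk⟩ := hcyl
    simp only [mem_iUnion]
    exact ⟨k, ⟨hki, hkj⟩, le_antisymm hk (hy.2 k), h⟩
  refine measure_mono_null hsub ?_
  refine measure_iUnion_null fun k => measure_iUnion_null fun hk => ?_
  have h := measure_level_inter_hyperplane hk.1 hk.2 hij ((1 / √2) * (x.1 i - x.1 j))
    (x.1 i - x.1 k)
  rwa [Measure.restrict_apply (measurableSet_eq_fun (by fun_prop) measurable_const)] at h

lemma gaussSurface_hyperplane_lt_top {i j : Fin q} (hij : i ≠ j) (c : ℝ) :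
    gaussSurface q {y | ⟪unitEdge q i j, y⟫ = c} < ⊤ := by
  rw [gaussSurface_eq i.pos,
    withDensity_apply _ (measurableSet_eq_fun (by fun_prop) measurable_const)]
  have h := integrable_stdGaussianDensity_hyperplane (norm_unitEdge hij) c
  rw [← ofReal_integral_eq_lintegral_ofReal h (ae_of_all _ fun y => (stdGaussianDensity_pos y).le)]
  exact ENNReal.ofReal_lt_top

lemma gaussSurface_openFacet_lt_top (x : E q) {i j : Fin q} (hij : i ≠ j) :
    gaussSurface q (openFacet x i j) < ⊤ :=
  (measure_mono inter_subset_right).trans_lt (gaussSurface_hyperplane_lt_top hij _)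

lemma gaussSurface_interface_lt_top (x : E q) {i j : Fin q} (hij : i ≠ j) :
    gaussSurface q (shift x (modelInterface q i j)) < ⊤ := by
  rw [← measure_congr (openFacet_ae_eq x hij)]
  exact gaussSurface_openFacet_lt_top x hij

/-- Integration by parts over a cell, in a direction that moves only its `j`-th facet. -/
lemma integral_cell_dualVec (x : E q) {i j : Fin q} (hij : i ≠ j) {f : E q → ℝ}
    (hf : Differentiable ℝ f) {C : ℝ} (hC : ∀ y, |f y| ≤ C) (hC' : ∀ y, ‖fderiv ℝ f y‖ ≤ C) :
    ∫ y in shift x (modelCell q i),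
        (fderiv ℝ f y (dualVec q j) - ⟪y, dualVec q j⟫ * f y) ∂(gauss q) =
      -((1 / √2) * ∫ y in openFacet x i j, f y ∂(gaussSurface q)) := by
  have h2 : (√2 : ℝ) ≠ 0 := by positivity
  have hw : ⟪unitEdge q i j, √2 • dualVec q j⟫ = 1 := by
    rw [inner_unitEdge]
    simp only [Submodule.coe_smul, PiLp.smul_apply, coord_dualVec, if_true, hij, if_false,
      smul_eq_mul]
    field_simp
    ring
  have hSw : ∀ y (t : ℝ), y + t • √2 • dualVec q j ∈ facetCylinder x i j ↔
      y ∈ facetCylinder x i j := fun y t => by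
    rw [smul_smul]
    exact add_smul_dualVec_mem_facetCylinder x hij y _
  have h := integral_halfSpace_stdGaussian (norm_unitEdge hij) hw ((1 / √2) * (x.1 i - x.1 j))
    (isOpen_facetCylinder x i j).measurableSet hSw hf hC hC'
  rw [← shift_modelCell_eq_inter x hij] at h
  have e : ∀ y : E q, fderiv ℝ f y (√2 • dualVec q j) - ⟪y, √2 • dualVec q j⟫ * f y =
      √2 * (fderiv ℝ f y (dualVec q j) - ⟪y, dualVec q j⟫ * f y) := fun y => by
    rw [map_smul, inner_smul_right y (dualVec q j), smul_eq_mul]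
    ring
  simp_rw [e] at h
  rw [integral_const_mul] at h
  have hs : ∫ y in openFacet x i j, f y ∂(gaussSurface q) =
      ∫ y in openFacet x i j, stdGaussianDensity (E q) y * f y
        ∂(μHE[finrank ℝ (E q) - 1] : Measure (E q)) := by
    rw [gaussSurface_eq i.pos, restrict_withDensity (measurableSet_openFacet x i j),
      integral_withDensity_eq_integral_toReal_smul
        (continuous_stdGaussianDensity.measurable.ennreal_ofReal) (by simp)]
    refine integral_congr_ae (ae_of_all _ fun y => ?_)
    simp [ENNReal.toReal_ofReal (stdGaussianDensity_pos y).le]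
  rw [hs, gauss]
  refine mul_left_cancel₀ h2 (h.trans ?_)
  rw [mul_neg, ← mul_assoc, mul_one_div_cancel h2, one_mul, openFacet]

lemma fderiv_inner_edge {X : E q → E q} (hX : Differentiable ℝ X) (i j : Fin q) (y : E q) :
    fderiv ℝ (fun y => ⟪edge q i j, X y⟫) y = (innerSL ℝ (edge q i j)).comp (fderiv ℝ X y) :=
  ((innerSL ℝ (edge q i j)).hasFDerivAt.comp y (hX y).hasFDerivAt).fderiv

/-- The Gauss–Green formula for a translated model cell, in terms of the relative interiors of its
facets. -/
theorem integral_cell_divergence (x : E q) (i : Fin q) {X : E q → E q} (hX : Differentiable ℝ X)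
    {C : ℝ} (hC : ∀ y, ‖X y‖ ≤ C) (hC' : ∀ y, ‖fderiv ℝ X y‖ ≤ C) :
    ∫ y in shift x (modelCell q i),
        (LinearMap.trace ℝ (E q) (fderiv ℝ X y : E q →ₗ[ℝ] E q) - ⟪y, X y⟫) ∂(gauss q) =
      ∑ j with j ≠ i, ∫ y in openFacet x i j, -⟪unitEdge q i j, X y⟫ ∂(gaussSurface q) := by
  set f : Fin q → E q → ℝ := fun j y => ⟪edge q i j, X y⟫ with hfdef
  have hf : ∀ j, Differentiable ℝ (f j) := fun j =>
    (innerSL ℝ (edge q i j)).differentiable.comp hX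
  set D : ℝ := ∑ j, ‖edge q i j‖ * C
  have hC0 : 0 ≤ C := (norm_nonneg _).trans (hC 0)
  have hD : ∀ j, ‖edge q i j‖ * C ≤ D := fun j =>
    Finset.single_le_sum (f := fun j => ‖edge q i j‖ * C) (fun j _ => by positivity)
      (Finset.mem_univ j)
  have hfC : ∀ j y, |f j y| ≤ D := fun j y =>
    ((abs_real_inner_le_norm _ _).trans (by gcongr; exact hC y)).trans (hD j)
  have hfC' : ∀ j y, ‖fderiv ℝ (f j) y‖ ≤ D := fun j y => by
    rw [fderiv_inner_edge hX]
    refine ((ContinuousLinearMap.opNorm_comp_le _ _).trans ?_).trans (hD j)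
    rw [innerSL_apply_norm]
    gcongr
    exact hC' y
  have hint : ∀ j, Integrable
      (fun y => fderiv ℝ (f j) y (dualVec q j) - ⟪y, dualVec q j⟫ * f j y) (gauss q) := fun j =>
    integrable_fderiv_sub_inner_mul (hf j) (hfC j) (hfC' j) _
  have e : ∀ y, LinearMap.trace ℝ (E q) (fderiv ℝ X y : E q →ₗ[ℝ] E q) - ⟪y, X y⟫ =
      ∑ j, (fderiv ℝ (f j) y (dualVec q j) - ⟪y, dualVec q j⟫ * f j y) := fun y => by
    rw [trace_eq_sum_edge i, Finset.sum_sub_distrib]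
    congr 1
    · refine Finset.sum_congr rfl fun j _ => ?_
      rw [fderiv_inner_edge hX]
      rfl
    · conv_lhs => rw [← sum_smul_dualVec i (X y)]
      rw [inner_sum]
      refine Finset.sum_congr rfl fun j _ => ?_
      rw [inner_smul_right y (dualVec q j), mul_comm, ← inner_edge]
  simp_rw [e]
  rw [integral_finsetSum _ fun j _ => (hint j).integrableOn, Finset.sum_filter]
  refine Finset.sum_congr rfl fun j _ => ?_
  split_ifs with hj
  · rw [integral_cell_dualVec x hj.symm (hf j) (hfC j) (hfC' j), integral_neg,
      ← integral_const_mul]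
    congr 2
    ext y
    rw [unitEdge, real_inner_smul_left (edge q i j) (X y)]
  · rw [not_not] at hj
    have h0 : f j = fun _ => 0 := by
      ext y
      rw [hj]
      exact (inner_edge i i (X y)).trans (sub_self _)
    simp [h0]

end GaussGreen

/-! ### The perimeter of a model cluster -/

section Perimeter

variable {q : ℕ}

lemma exists_bound_of_hasCompactSupport {V : Type*} [NormedAddCommGroup V] [NormedSpace ℝ V]
    {X : V → V} (hX : ContDiff ℝ ∞ X)
    (hs : HasCompactSupport X) :
    ∃ C, (∀ y, ‖X y‖ ≤ C) ∧ ∀ y, ‖fderiv ℝ X y‖ ≤ C := by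
  obtain ⟨C₁, h₁⟩ := hs.exists_bound_of_continuous hX.continuous
  obtain ⟨C₂, h₂⟩ := (hs.fderiv (𝕜 := ℝ)).exists_bound_of_continuous
    (hX.continuous_fderiv (by simp))
  exact ⟨max C₁ C₂, fun y => (h₁ y).trans (le_max_left _ _),
    fun y => (h₂ y).trans (le_max_right _ _)⟩

lemma perimeter_cell_le (x : E q) (i : Fin q) : perimeter q (shift x (modelCell q i)) ≤
    ∑ j with j ≠ i, gaussSurface q (openFacet x i j) := by
  refine iSup_le fun X => iSup_le fun hX => iSup_le fun hs => iSup_le fun h1 => ?_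
  obtain ⟨C, hC, hC'⟩ := exists_bound_of_hasCompactSupport hX hs
  rw [integral_cell_divergence x i (hX.differentiable (by simp)) hC hC',
    ← ENNReal.ofReal_toReal (ENNReal.sum_lt_top.2 fun j hj =>
      gaussSurface_openFacet_lt_top x (Finset.mem_filter.1 hj).2.symm).ne]
  refine ENNReal.ofReal_le_ofReal ?_
  rw [ENNReal.toReal_sum fun j hj =>
    (gaussSurface_openFacet_lt_top x (Finset.mem_filter.1 hj).2.symm).ne]
  refine Finset.sum_le_sum fun j hj => ?_
  have hij : i ≠ j := (Finset.mem_filter.1 hj).2.symm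
  have h := norm_setIntegral_le_of_norm_le_const (μ := gaussSurface q) (C := 1)
    (f := fun y => -⟪unitEdge q i j, X y⟫) (gaussSurface_openFacet_lt_top x hij) fun y _ => by
      rw [norm_neg]
      refine (norm_inner_le_norm _ _).trans ?_
      rw [norm_unitEdge hij, one_mul]
      exact h1 y
  exact (le_abs_self _).trans (by simpa [Measure.real] using h)

/-- The signed excess of `y` over the `k`-th facet of the `i`-th translated cell. -/
def facetExcess (x : E q) (i k : Fin q) (y : E q) : ℝ := y.1 i - y.1 k - (x.1 i - x.1 k)

/-- A smooth function which is supported near the hyperplane of the `j`-th facet of the `i`-th cell,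
well inside the half-spaces of the other facets, and tends to `1` on the relative interior of the
`j`-th facet as `n → ∞`. For distinct `j` the supports are disjoint. -/
noncomputable def facetCutoff (x : E q) (i j : Fin q) (n : ℕ) (y : E q) : ℝ :=
  Real.smoothTransition (2 - (n * facetExcess x i j y) ^ 2) *
    ∏ k with k ≠ i ∧ k ≠ j, Real.smoothTransition (n * facetExcess x i k y - 2)

/-- Compactly supported smooth vector fields that converge to the outer unit normal on the relative
interior of each facet of the `i`-th cell. -/
noncomputable def facetField (x : E q) (i : Fin q) (n : ℕ) (y : E q) : E q :=
  -(Real.smoothTransition (n + 1 - ‖y‖ ^ 2) • ∑ j with j ≠ i, facetCutoff x i j n y • unitEdge q i j)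

lemma contDiff_coord (i : Fin q) : ContDiff ℝ ∞ fun y : E q => y.1 i :=
  ((EuclideanSpace.proj i : EuclideanSpace ℝ (Fin q) →L[ℝ] ℝ).comp (E q).subtypeL).contDiff

lemma contDiff_facetExcess (x : E q) (i k : Fin q) : ContDiff ℝ ∞ (facetExcess x i k) :=
  ((contDiff_coord i).sub (contDiff_coord k)).sub contDiff_const

lemma contDiff_facetField (x : E q) (i : Fin q) (n : ℕ) : ContDiff ℝ ∞ (facetField x i n) := by
  have hst : ContDiff ℝ ∞ Real.smoothTransition := Real.smoothTransition.contDiff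
  have h1 : ∀ j, ContDiff ℝ ∞ (facetCutoff x i j n) := fun j =>
    (hst.comp (contDiff_const.sub ((contDiff_const.mul (contDiff_facetExcess x i j)).pow 2))).mul
      (contDiff_prod fun k _ =>
        hst.comp ((contDiff_const.mul (contDiff_facetExcess x i k)).sub contDiff_const))
  have h2 : ∀ j, ContDiff ℝ ∞ fun y => facetCutoff x i j n y • unitEdge q i j := fun j =>
    (h1 j).smul contDiff_const
  have h3 : ContDiff ℝ ∞ fun y => ∑ j with j ≠ i, facetCutoff x i j n y • unitEdge q i j :=
    ContDiff.sum fun j _ => h2 j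
  have h4 : ContDiff ℝ ∞ fun y : E q => Real.smoothTransition (n + 1 - ‖y‖ ^ 2) :=
    hst.comp (contDiff_const.sub (contDiff_norm_sq ℝ))
  exact (h4.smul h3).neg

lemma hasCompactSupport_facetField (x : E q) (i : Fin q) (n : ℕ) :
    HasCompactSupport (facetField x i n) := by
  refine HasCompactSupport.intro (isCompact_closedBall 0 (n + 1)) fun y hy => ?_
  rw [mem_closedBall_zero_iff, not_le] at hy
  rw [facetField, Real.smoothTransition.zero_of_nonpos, zero_smul, neg_zero]
  have : (0 : ℝ) ≤ n := n.cast_nonneg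
  nlinarith

lemma facetCutoff_nonneg (x : E q) (i j : Fin q) (n : ℕ) (y : E q) : 0 ≤ facetCutoff x i j n y :=
  mul_nonneg (Real.smoothTransition.nonneg _)
    (Finset.prod_nonneg fun _ _ => Real.smoothTransition.nonneg _)

lemma facetCutoff_le_one (x : E q) (i j : Fin q) (n : ℕ) (y : E q) : facetCutoff x i j n y ≤ 1 :=
  mul_le_one₀ (Real.smoothTransition.le_one _)
    (Finset.prod_nonneg fun _ _ => Real.smoothTransition.nonneg _)
    (Finset.prod_le_one (fun _ _ => Real.smoothTransition.nonneg _)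
      fun _ _ => Real.smoothTransition.le_one _)

lemma facetCutoff_eq_zero_of_sq_lt {x : E q} {i j k : Fin q} (hki : k ≠ i) (hkj : k ≠ j) {n : ℕ}
    {y : E q} (h : (n * facetExcess x i k y) ^ 2 < 2) : facetCutoff x i j n y = 0 := by
  refine mul_eq_zero_of_right _ (Finset.prod_eq_zero (i := k) (by simp [hki, hkj]) ?_)
  refine Real.smoothTransition.zero_of_nonpos ?_
  nlinarith

lemma facetCutoff_eq_zero_of_ne {x : E q} {i j k : Fin q} (hki : k ≠ i) (hkj : k ≠ j) {n : ℕ}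
    {y : E q} (h : facetCutoff x i k n y ≠ 0) : facetCutoff x i j n y = 0 := by
  refine facetCutoff_eq_zero_of_sq_lt hki hkj ?_
  by_contra! h'
  exact h (mul_eq_zero_of_left (Real.smoothTransition.zero_of_nonpos (by linarith)) _)

lemma norm_facetField_le_one (x : E q) (i : Fin q) (n : ℕ) (y : E q) :
    ‖facetField x i n y‖ ≤ 1 := by
  have hsum : ‖∑ j with j ≠ i, facetCutoff x i j n y • unitEdge q i j‖ ≤ 1 := by
    by_cases h : ∃ k, k ≠ i ∧ facetCutoff x i k n y ≠ 0
    · obtain ⟨k, hki, hk⟩ := h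
      rw [Finset.sum_eq_single k
        (fun j _ hjk => by rw [facetCutoff_eq_zero_of_ne hki hjk.symm hk, zero_smul])
        (fun hk' => absurd (Finset.mem_filter.2 ⟨Finset.mem_univ k, hki⟩) hk'),
        norm_smul, norm_unitEdge hki.symm, mul_one,
        Real.norm_of_nonneg (facetCutoff_nonneg _ _ _ _ _)]
      exact facetCutoff_le_one _ _ _ _ _
    · push Not at h
      rw [Finset.sum_eq_zero fun j hj => by rw [h j (Finset.mem_filter.1 hj).2, zero_smul]]
      simp
  rw [facetField, norm_neg, norm_smul, Real.norm_of_nonneg (Real.smoothTransition.nonneg _)]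
  exact mul_le_one₀ (Real.smoothTransition.le_one _) (norm_nonneg _) hsum

lemma eventually_facetField_eq {x : E q} {i j : Fin q} (hij : i ≠ j) {y : E q}
    (hy : y ∈ openFacet x i j) : ∀ᶠ n : ℕ in atTop, facetField x i n y = -unitEdge q i j := by
  have hj : facetExcess x i j y = 0 := by
    have := (openFacet_subset_shift_modelInterface x hij hy)
    rw [shift_modelInterface x hij] at this
    rw [facetExcess, this.1, sub_self]
  have hk : ∀ k, k ≠ i → k ≠ j → ∀ᶠ n : ℕ in atTop, 3 ≤ n * facetExcess x i k y := by
    intro k hki hkj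
    have hpos : 0 < facetExcess x i k y := sub_pos.2 (hy.1 k hki hkj)
    exact (tendsto_natCast_atTop_atTop.atTop_mul_const hpos).eventually_ge_atTop 3
  have hn : ∀ᶠ n : ℕ in atTop, ‖y‖ ^ 2 ≤ n :=
    tendsto_natCast_atTop_atTop.eventually_ge_atTop _
  have hk' : ∀ᶠ n : ℕ in atTop, ∀ k, k ≠ i → k ≠ j → 3 ≤ n * facetExcess x i k y :=
    eventually_all.2 fun k => eventually_imp_distrib_left.2 fun h1 =>
      eventually_imp_distrib_left.2 fun h2 => hk k h1 h2
  filter_upwards [hn, hk'] with n h1 h2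
  rw [facetField, Real.smoothTransition.one_of_one_le (by linarith), one_smul,
    Finset.sum_eq_single j]
  · have : facetCutoff x i j n y = 1 := by
      rw [facetCutoff, hj, Real.smoothTransition.one_of_one_le (by norm_num), one_mul]
      refine Finset.prod_eq_one fun k hk => Real.smoothTransition.one_of_one_le ?_
      have hk := (Finset.mem_filter.1 hk).2
      linarith [h2 k hk.1 hk.2]
    rw [this, one_smul]
  · intro k _ hkj
    rw [facetCutoff_eq_zero_of_sq_lt hij.symm hkj.symm (by rw [hj]; norm_num), zero_smul]
  · exact fun h => absurd (Finset.mem_filter.2 ⟨Finset.mem_univ j, hij.symm⟩) h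

lemma le_perimeter_cell (x : E q) (i : Fin q) :
    ∑ j with j ≠ i, gaussSurface q (openFacet x i j) ≤
      perimeter q (shift x (modelCell q i)) := by
  have hlim : Tendsto (fun n : ℕ => ∑ j with j ≠ i, ∫ y in openFacet x i j,
      -⟪unitEdge q i j, facetField x i n y⟫ ∂(gaussSurface q)) atTop
      (𝓝 (∑ j with j ≠ i, (gaussSurface q (openFacet x i j)).toReal)) := by
    refine tendsto_finsetSum _ fun j hj => ?_
    have hij : i ≠ j := (Finset.mem_filter.1 hj).2.symm
    have hfin : IsFiniteMeasure ((gaussSurface q).restrict (openFacet x i j)) :=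
      ⟨by simpa using gaussSurface_openFacet_lt_top x hij⟩
    have e : (gaussSurface q (openFacet x i j)).toReal =
        ∫ _ in openFacet x i j, (1 : ℝ) ∂(gaussSurface q) := by
      simp [Measure.real]
    rw [e]
    refine tendsto_integral_of_dominated_convergence (fun _ => 1) (fun n => ?_)
      (integrable_const _) (fun n => ae_of_all _ fun y => ?_) ?_
    · exact (continuous_const.inner (contDiff_facetField x i n).continuous).neg.aestronglyMeasurable
    · rw [norm_neg]
      refine (norm_inner_le_norm _ _).trans ?_
      rw [norm_unitEdge hij, one_mul]
      exact norm_facetField_le_one x i n y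
    · filter_upwards [ae_restrict_mem (measurableSet_openFacet x i j)] with y hy
      refine tendsto_const_nhds.congr' ?_
      filter_upwards [eventually_facetField_eq hij hy] with n hn
      rw [hn, inner_neg_right, neg_neg, real_inner_self_eq_norm_sq, norm_unitEdge hij, one_pow]
  rw [← ENNReal.toReal_sum fun j hj =>
    (gaussSurface_openFacet_lt_top x (Finset.mem_filter.1 hj).2.symm).ne] at hlim
  rw [← ENNReal.ofReal_toReal (ENNReal.sum_lt_top.2 fun j hj =>
      gaussSurface_openFacet_lt_top x (Finset.mem_filter.1 hj).2.symm).ne]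
  refine le_of_tendsto' ((ENNReal.continuous_ofReal.tendsto _).comp hlim) fun n => ?_
  have hX := contDiff_facetField x i n
  have hs := hasCompactSupport_facetField x i n
  obtain ⟨C, hC, hC'⟩ := exists_bound_of_hasCompactSupport hX hs
  rw [Function.comp, ← integral_cell_divergence x i (hX.differentiable (by simp)) hC hC']
  exact le_iSup_of_le _ (le_iSup_of_le hX (le_iSup_of_le hs
    (le_iSup_of_le (norm_facetField_le_one x i n) le_rfl)))

theorem perimeter_cell (x : E q) (i : Fin q) : perimeter q (shift x (modelCell q i)) =
    ∑ j with j ≠ i, gaussSurface q (shift x (modelInterface q i j)) := by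
  rw [(perimeter_cell_le x i).antisymm (le_perimeter_cell x i)]
  exact Finset.sum_congr rfl fun j hj =>
    measure_congr (openFacet_ae_eq x (Finset.mem_filter.1 hj).2.symm)

lemma sum_ne_eq_two_mul_sum_lt {R : Type*} [NonAssocSemiring R] {a : Fin q → Fin q → R}
    (ha : ∀ i j, a i j = a j i) :
    ∑ i, ∑ j with j ≠ i, a i j = 2 * ∑ i, ∑ j with i < j, a i j := by
  have h : ∀ i, ∑ j with j ≠ i, a i j = ∑ j with i < j, a i j + ∑ j with j < i, a i j := by
    intro i
    rw [← Finset.sum_union]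
    · refine Finset.sum_congr ?_ fun _ _ => rfl
      ext j
      simp [lt_or_lt_iff_ne, ne_comm]
    · exact Finset.disjoint_filter.2 fun j _ h1 h2 => lt_asymm h1 h2
  simp_rw [h, Finset.sum_add_distrib, two_mul]
  congr 1
  simp_rw [Finset.sum_filter]
  rw [Finset.sum_comm]
  simp_rw [fun i j => ha j i]

theorem clusterPerimeter_cells (x : E q) :
    clusterPerimeter q (fun i => shift x (modelCell q i)) =
      ∑ i, ∑ j with i < j, gaussSurface q (shift x (modelInterface q i j)) := by
  rw [clusterPerimeter]
  simp_rw [perimeter_cell]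
  rw [sum_ne_eq_two_mul_sum_lt fun i j => by rw [modelInterface_comm], ← mul_assoc, one_div,
    ENNReal.inv_mul_cancel two_ne_zero ENNReal.ofNat_ne_top, one_mul]

lemma clusterPerimeter_cells_ne_top (x : E q) :
    clusterPerimeter q (fun i => shift x (modelCell q i)) ≠ ⊤ := by
  rw [clusterPerimeter_cells]
  exact (ENNReal.sum_lt_top.2 fun i _ => ENNReal.sum_lt_top.2 fun j hj =>
    gaussSurface_interface_lt_top x (Finset.mem_filter.1 hj).2.ne).ne

end Perimeter

/-! ### The operator `L_A` -/

section Operator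

variable {q : ℕ}

lemma L_apply (A : Fin q → Fin q → ℝ) (v : E q) :
    L q A v = ∑ i, ∑ j with i < j, (A i j * (v.1 i - v.1 j)) • edge q i j := by
  simp only [L, _root_.sum_apply, _root_.smul_apply, ContinuousLinearMap.smulRight_apply]
  refine Finset.sum_congr rfl fun i _ => Finset.sum_congr rfl fun j _ => ?_
  rw [smul_smul]
  congr 2
  exact inner_edge i j v

lemma inner_L (A : Fin q → Fin q → ℝ) (v z : E q) :
    ⟪L q A v, z⟫ = ∑ i, ∑ j with i < j, A i j * ((v.1 i - v.1 j) * (z.1 i - z.1 j)) := by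
  rw [L_apply, sum_inner]
  refine Finset.sum_congr rfl fun i _ => ?_
  rw [sum_inner]
  refine Finset.sum_congr rfl fun j _ => ?_
  rw [real_inner_smul_left (edge q i j) z, inner_edge]
  ring

lemma coord_L {A : Fin q → Fin q → ℝ} (hA : ∀ i j, A i j = A j i) (v : E q) (k : Fin q) :
    (L q A v).1 k = ∑ j, A k j * (v.1 k - v.1 j) := by
  have h1 : (L q A v).1 k = ∑ i, ∑ j with i < j,
      A i j * (v.1 i - v.1 j) * ((if k = i then 1 else 0) - (if k = j then 1 else 0)) := by
    rw [L_apply]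
    simp [edge, Pi.single_apply]
  have h2 := sum_ne_eq_two_mul_sum_lt (a := fun i j => A i j * (v.1 i - v.1 j) *
    ((if k = i then 1 else 0) - (if k = j then 1 else 0))) fun i j => by rw [hA]; ring
  have h3 : ∀ i : Fin q, ∑ j with j ≠ i, A i j * (v.1 i - v.1 j) *
      ((if k = i then 1 else 0) - (if k = j then 1 else 0)) = ∑ j, A i j * (v.1 i - v.1 j) *
      ((if k = i then 1 else 0) - (if k = j then 1 else 0)) := fun i =>
    Finset.sum_filter_of_ne fun j _ h => by
      rintro rfl
      simp at h
  have h5 : ∀ i j : Fin q, A i j * (v.1 i - v.1 j) *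
      ((if k = i then 1 else 0) - (if k = j then 1 else 0)) =
      (if k = i then A i j * (v.1 i - v.1 j) else 0) -
        (if k = j then A i j * (v.1 i - v.1 j) else 0) := fun i j => by
    split_ifs <;> ring
  rw [← h1] at h2
  simp_rw [h3, h5, Finset.sum_sub_distrib] at h2
  rw [Finset.sum_comm] at h2
  simp only [Finset.sum_ite_eq, Finset.mem_univ, if_true] at h2
  have h4 : ∑ i, A i k * (v.1 i - v.1 k) = -∑ j, A k j * (v.1 k - v.1 j) := by
    rw [← Finset.sum_neg_distrib]
    exact Finset.sum_congr rfl fun i _ => by rw [hA]; ring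
  linarith

lemma inner_L_self_pos {A : Fin q → Fin q → ℝ} (hA : ∀ i j, i ≠ j → 0 < A i j) {v : E q}
    (hv : v ≠ 0) : 0 < ⟪L q A v, v⟫ := by
  rw [inner_L]
  have hnn : ∀ i, ∀ j ∈ Finset.univ.filter (i < ·),
      0 ≤ A i j * ((v.1 i - v.1 j) * (v.1 i - v.1 j)) := fun i j hj =>
    mul_nonneg (hA i j (Finset.mem_filter.1 hj).2.ne).le (mul_self_nonneg _)
  refine lt_of_le_of_ne (Finset.sum_nonneg fun i _ => Finset.sum_nonneg (hnn i)) fun h => hv ?_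
  have h0 : ∀ i j, i < j → v.1 i = v.1 j := by
    intro i j hij
    have h1 := (Finset.sum_eq_zero_iff_of_nonneg fun i _ => Finset.sum_nonneg (hnn i)).1 h.symm i
      (Finset.mem_univ i)
    have h2 := (Finset.sum_eq_zero_iff_of_nonneg (hnn i)).1 h1 j (by simp [hij])
    rcases mul_eq_zero.1 h2 with h3 | h3
    · exact absurd h3 (hA i j hij.ne).ne'
    · linarith [mul_self_eq_zero.1 h3]
  have h1 : ∀ i j, v.1 i = v.1 j := fun i j => by
    rcases lt_trichotomy i j with h | h | h
    · exact h0 i j h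
    · rw [h]
    · exact (h0 j i h).symm
  ext i
  have hs := sum_coord_eq_zero v
  rw [Finset.sum_congr rfl fun j _ => h1 j i] at hs
  have hq : (q : ℝ) ≠ 0 := by
    have := i.pos
    positivity
  simpa [hq] using hs

lemma isInvertible_L {A : Fin q → Fin q → ℝ} (hA : ∀ i j, i ≠ j → 0 < A i j) :
    (L q A).IsInvertible := by
  have hinj : Function.Injective (L q A : E q →ₗ[ℝ] E q) := by
    rw [injective_iff_map_eq_zero]
    intro v hv
    by_contra h
    have := inner_L_self_pos hA h
    rw [show L q A v = 0 from hv, inner_zero_left] at this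
    exact lt_irrefl _ this
  refine ⟨(LinearEquiv.ofInjectiveEndo _ hinj).toContinuousLinearEquiv, ?_⟩
  ext1 v
  rfl

end Operator

/-! ### Measures, areas and first moments of the cells -/

section Psi

variable {q : ℕ}

instance isProbabilityMeasure_gauss : IsProbabilityMeasure (gauss q) :=
  inferInstanceAs (IsProbabilityMeasure (stdGaussian (E q)))

lemma volume_absolutelyContinuous_gauss : (volume : Measure (E q)) ≪ gauss q := by
  rw [gauss, stdGaussian_eq_withDensity]
  exact withDensity_absolutelyContinuous'
    continuous_stdGaussianDensity.measurable.ennreal_ofReal.aemeasurable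
    (ae_of_all _ fun y => by simpa using stdGaussianDensity_pos y)

lemma gauss_absolutelyContinuous_volume : gauss q ≪ (volume : Measure (E q)) := by
  rw [gauss, stdGaussian_eq_withDensity]
  exact withDensity_absolutelyContinuous _ _

lemma modelArea_comm (x : E q) (i j : Fin q) : modelArea q x i j = modelArea q x j i := by
  rw [modelArea, modelArea, modelInterface_comm]

lemma modelArea_eq_openFacet (x : E q) {i j : Fin q} (hij : i ≠ j) :
    modelArea q x i j = (gaussSurface q (openFacet x i j)).toReal := by
  rw [modelArea, measure_congr (openFacet_ae_eq x hij)]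

lemma modelArea_pos (x : E q) {i j : Fin q} (hij : i ≠ j) : 0 < modelArea q x i j := by
  rw [modelArea_eq_openFacet x hij, ENNReal.toReal_pos_iff]
  refine ⟨pos_iff_ne_zero.2 fun h => ?_, gaussSurface_openFacet_lt_top x hij⟩
  have hac : (μHE[finrank ℝ (E q) - 1] : Measure (E q)) ≪ gaussSurface q := by
    rw [gaussSurface_eq i.pos]
    exact withDensity_absolutelyContinuous'
      continuous_stdGaussianDensity.measurable.ennreal_ofReal.aemeasurable
      (ae_of_all _ fun y => by simpa using stdGaussianDensity_pos y)
  have h0 := hac h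
  set c := (1 / √2) * (x.1 i - x.1 j)
  have h1 : Measure.map (fun z : (ℝ ∙ unitEdge q i j)ᗮ => c • unitEdge q i j + (z : E q)) volume
      (facetCylinder x i j) = 0 := by
    rw [map_orthogonal_eq_restrict (norm_unitEdge hij),
      Measure.restrict_apply (isOpen_facetCylinder x i j).measurableSet]
    exact h0
  rw [(measurableEmbedding_add_orthogonal _ _).map_apply] at h1
  have hopen : IsOpen ((fun z : (ℝ ∙ unitEdge q i j)ᗮ => c • unitEdge q i j + (z : E q)) ⁻¹'
      facetCylinder x i j) := (isOpen_facetCylinder x i j).preimage (by fun_prop)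
  have hemp := hopen.measure_eq_zero_iff volume |>.1 h1
  have hy : ∀ k, (x - dualVec q i - dualVec q j).1 k = x.1 k - 2 / q + (if k = i then 1 else 0) +
      (if k = j then 1 else 0) := fun k => by
    simp only [Submodule.coe_sub, PiLp.sub_apply, coord_dualVec]
    ring
  have hz : x - dualVec q i - dualVec q j - c • unitEdge q i j ∈ (ℝ ∙ unitEdge q i j)ᗮ := by
    rw [Submodule.mem_orthogonal_singleton_iff_inner_right, inner_sub_right,
      inner_smul_right (unitEdge q i j) (unitEdge q i j), real_inner_self_eq_norm_sq,
      norm_unitEdge hij, inner_unitEdge, hy, hy]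
    simp [hij, hij.symm, c]
  have hmem : (⟨_, hz⟩ : (ℝ ∙ unitEdge q i j)ᗮ) ∈
      ((fun z : (ℝ ∙ unitEdge q i j)ᗮ => c • unitEdge q i j + (z : E q)) ⁻¹'
        facetCylinder x i j) := by
    rw [mem_preimage, add_sub_cancel]
    intro k hki hkj
    rw [hy, hy]
    simp only [if_true, hij, hki, hkj, if_false]
    linarith
  rw [hemp] at hmem
  exact hmem

lemma ae_mem_cell (hq : 1 ≤ q) (x : E q) :
    ∀ᵐ y ∂(gauss q), ∃ i, y ∈ shift x (modelCell q i) := by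
  have hnull : ∀ i j : Fin q, i ≠ j → ∀ᵐ y ∂(gauss q), y.1 i - y.1 j ≠ x.1 i - x.1 j := by
    intro i j hij
    refine gauss_absolutelyContinuous_volume.ae_le ?_
    have hne : (innerSL ℝ (edge q i j) : E q →ₗ[ℝ] ℝ) ≠ 0 := fun h => by
      have := LinearMap.congr_fun h (edge q i j)
      change ⟪edge q i j, edge q i j⟫ = 0 at this
      rw [inner_edge] at this
      simp [edge, hij, hij.symm] at this
    have := volume_level_set_eq_zero hne (x.1 i - x.1 j)
    refine ae_iff.2 ?_
    simp only [ne_eq, not_not]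
    simp only [← inner_edge] at this ⊢
    exact this
  have hall : ∀ᵐ y ∂(gauss q), ∀ i j : Fin q, i ≠ j → y.1 i - y.1 j ≠ x.1 i - x.1 j := by
    simp only [ae_all_iff]
    exact hnull
  filter_upwards [hall] with y hy
  have : Nonempty (Fin q) := ⟨⟨0, hq⟩⟩
  obtain ⟨i, hi⟩ := Finite.exists_max fun i => y.1 i - x.1 i
  refine ⟨i, ?_⟩
  rw [shift_modelCell]
  intro j hj
  refine lt_of_le_of_ne ?_ (hy i j hj.symm).symm
  linarith [hi j]

lemma disjoint_cells (x : E q) {i j : Fin q} (hij : i ≠ j) :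
    Disjoint (shift x (modelCell q i)) (shift x (modelCell q j)) := by
  rw [disjoint_left]
  intro y hi hj
  rw [shift_modelCell] at hi hj
  have h1 := hi j hij.symm
  have h2 := hj i hij
  linarith

lemma Psi_apply (x : E q) (i : Fin q) :
    (Psi q x) i = (gauss q).real (shift x (modelCell q i)) := rfl

/-- Integration over the whole space is summation over the cells. -/
lemma integral_eq_sum_cells (hq : 1 ≤ q) (x : E q) {f : E q → ℝ} (hf : Integrable f (gauss q)) :
    ∫ y, f y ∂(gauss q) = ∑ i, ∫ y in shift x (modelCell q i), f y ∂(gauss q) := by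
  rw [← integral_iUnion_fintype (fun i => (isOpen_shift_modelCell x i).measurableSet)
    (fun i j hij => disjoint_cells x hij) (fun i => hf.integrableOn)]
  rw [← setIntegral_univ]
  refine setIntegral_congr_set ?_
  filter_upwards [ae_mem_cell hq x] with y hy
  simp only [eq_iff_iff]
  exact ⟨fun _ => mem_iUnion.2 hy, fun _ => mem_univ y⟩

lemma sum_Psi (hq : 1 ≤ q) (x : E q) : ∑ i, (Psi q x) i = 1 := by
  have h := integral_eq_sum_cells hq x (integrable_const (1 : ℝ))
  simpa [Psi_apply] using h.symm

lemma Psi_pos (x : E q) (i : Fin q) : 0 < (Psi q x) i := by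
  rw [Psi_apply, measureReal_def, ENNReal.toReal_pos_iff]
  refine ⟨pos_iff_ne_zero.2 fun h => ?_, measure_lt_top _ _⟩
  have h0 := volume_absolutelyContinuous_gauss h
  rw [(isOpen_shift_modelCell x i).measure_eq_zero_iff volume] at h0
  have : x - dualVec q i ∈ shift x (modelCell q i) := by
    rw [shift_modelCell]
    intro j hj
    simp only [Submodule.coe_sub, PiLp.sub_apply, coord_dualVec, if_true, hj, if_false]
    linarith
  rw [h0] at this
  exact this

lemma Psi_mem_simplexInterior (hq : 1 ≤ q) (x : E q) : Psi q x ∈ simplexInterior q :=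
  ⟨Psi_pos x, sum_Psi hq x⟩

/-- The first moment of a cell, from the Gauss–Green formula for constant vector fields. -/
lemma integral_cell_inner (x : E q) (i : Fin q) (v : E q) :
    ∫ y in shift x (modelCell q i), ⟪y, v⟫ ∂(gauss q) =
      (1 / √2) * ∑ j, modelArea q x i j * (v.1 i - v.1 j) := by
  have h := integral_cell_divergence x i (X := fun _ => v) (differentiable_const v)
    (C := ‖v‖) (fun _ => le_rfl) (fun y => by rw [fderiv_fun_const]; exact (norm_zero (E := E q →L[ℝ] E q)).trans_le (norm_nonneg v))
  simp only [fderiv_fun_const, Pi.zero_apply, ContinuousLinearMap.toLinearMap_zero, map_zero, zero_sub,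
    integral_neg, integral_const] at h
  rw [Finset.sum_neg_distrib, neg_inj] at h
  rw [h, Finset.mul_sum, Finset.sum_filter]
  refine Finset.sum_congr rfl fun j _ => ?_
  split_ifs with hj
  · rw [modelArea_eq_openFacet x (Ne.symm hj), inner_unitEdge, smul_eq_mul, measureReal_def,
      Measure.restrict_apply_univ]
    ring
  · rw [not_not] at hj
    rw [hj, sub_self, mul_zero, mul_zero]

end Psi

/-! ### The Gaussian measure of the translates of a set -/

section Translates

variable {V : Type} [NormedAddCommGroup V] [InnerProductSpace ℝ V] [FiniteDimensional ℝ V]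
  [MeasurableSpace V] [BorelSpace V]

lemma stdGaussian_real_add_image {S : Set V} (hS : MeasurableSet S) (x : V) :
    (stdGaussian V).real ((fun y => x + y) '' S) =
      Real.exp (-‖x‖ ^ 2 / 2) *
        ∫ y, Real.exp ⟪-x, y⟫ • S.indicator (fun _ => (1 : ℝ)) y ∂(stdGaussian V) := by
  have h := setIntegral_add_image_stdGaussian x hS (fun _ => (1 : ℝ))
  have h1 : ∫ _ in (fun y => x + y) '' S, (1 : ℝ) ∂(stdGaussian V) =
      (stdGaussian V).real ((fun y => x + y) '' S) := by simp
  rw [← h1, h, ← integral_indicator hS, ← integral_const_mul]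
  congr 1
  ext y
  by_cases hy : y ∈ S
  · simp only [hy, indicator_of_mem, smul_eq_mul, mul_one]
    rw [← Real.exp_add]
    congr 1
    ring
  · simp [hy]

lemma integrable_exp_norm_mul_indicator {S : Set V} (hS : MeasurableSet S) (a : ℝ) :
    Integrable (fun y : V => Real.exp (a * ‖y‖) * ‖S.indicator (fun _ => (1 : ℝ)) y‖)
      (stdGaussian V) := by
  refine (integrable_exp_norm_stdGaussian a).mono' ?_ (ae_of_all _ fun y => ?_)
  · exact ((by fun_prop : Measurable fun y : V => Real.exp (a * ‖y‖)).mul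
      ((measurable_const.indicator hS).norm)).aestronglyMeasurable
  · by_cases hy : y ∈ S <;> simp [hy, Real.exp_nonneg]

lemma contDiff_stdGaussian_translate {S : Set V} (hS : MeasurableSet S) :
    ContDiff ℝ ∞ fun x => (stdGaussian V).real ((fun y => x + y) '' S) := by
  simp_rw [stdGaussian_real_add_image hS]
  have hm : AEStronglyMeasurable (S.indicator fun _ => (1 : ℝ)) (stdGaussian V) :=
    (measurable_const.indicator hS).aestronglyMeasurable
  have h1 : ContDiff ℝ ∞ fun x : V =>
      ∫ y, Real.exp ⟪x, y⟫ • S.indicator (fun _ => (1 : ℝ)) y ∂(stdGaussian V) :=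
    contDiff_infty.2 fun n =>
      contDiff_integral_exp_inner n hm (integrable_exp_norm_mul_indicator hS)
  exact (((contDiff_norm_sq ℝ).neg.div_const 2).exp).mul (h1.comp contDiff_neg)

/-- Moving a set changes its Gaussian measure at the rate given by its first moment. -/
lemma fderiv_stdGaussian_translate {S : Set V} (hS : MeasurableSet S) (x v : V) :
    fderiv ℝ (fun x => (stdGaussian V).real ((fun y => x + y) '' S)) x v =
      -∫ y in (fun y => x + y) '' S, ⟪y, v⟫ ∂(stdGaussian V) := by
  have hm : AEStronglyMeasurable (S.indicator fun _ => (1 : ℝ)) (stdGaussian V) :=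
    (measurable_const.indicator hS).aestronglyMeasurable
  have hexp := integrable_exp_norm_mul_indicator hS
  have hm' : ∀ x : V, AEStronglyMeasurable
      (fun y => Real.exp ⟪x, y⟫ • (innerSL ℝ y).smulRight (S.indicator (fun _ => (1 : ℝ)) y))
      (stdGaussian V) := fun x =>
    (by fun_prop : Continuous fun y : V => Real.exp ⟪x, y⟫).aestronglyMeasurable.smul
      (aestronglyMeasurable_innerSL_smulRight hm)
  have hint : ∀ x : V, Integrable
      (fun y => Real.exp ⟪x, y⟫ • (innerSL ℝ y).smulRight (S.indicator (fun _ => (1 : ℝ)) y))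
      (stdGaussian V) := fun x => by
    refine (hexp (‖x‖ + 1)).mono' (hm' x) (ae_of_all _ fun y => ?_)
    rw [norm_smul, Real.norm_of_nonneg (Real.exp_pos _).le,
      ContinuousLinearMap.norm_smulRight_apply, innerSL_apply_norm, ← mul_assoc, add_mul,
      Real.exp_add, one_mul]
    gcongr
    · exact real_inner_le_norm x y
    · linarith [Real.add_one_le_exp ‖y‖]
  have hint0 : Integrable
      (fun y => Real.exp ⟪-x, y⟫ • S.indicator (fun _ => (1 : ℝ)) y) (stdGaussian V) := by
    refine (hexp ‖x‖).mono' ((by fun_prop : Continuous fun y : V =>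
      Real.exp ⟪-x, y⟫).aestronglyMeasurable.smul hm) (ae_of_all _ fun y => ?_)
    rw [norm_smul, Real.norm_of_nonneg (Real.exp_pos _).le]
    gcongr
    exact (real_inner_le_norm _ y).trans (by rw [norm_neg])
  have h1 := (hasFDerivAt_integral_exp_inner hm hexp (-x)).comp x (hasFDerivAt_id x).neg
  have h2 := hasFDerivAt_neg_norm_sq_div_two x
  have h3 := h2.exp.fun_mul h1
  simp_rw [stdGaussian_real_add_image hS]
  have h4 : (∫ y, Real.exp ⟪-x, y⟫ • (innerSL ℝ y).smulRight (S.indicator (fun _ => (1 : ℝ)) y)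
      ∂(stdGaussian V)) v = ∫ y, Real.exp ⟪-x, y⟫ * (⟪y, v⟫ * S.indicator (fun _ => (1 : ℝ)) y)
      ∂(stdGaussian V) := by
    rw [ContinuousLinearMap.integral_apply (hint (-x))]
    rfl
  have hint1 : Integrable (fun y => Real.exp ⟪-x, y⟫ *
      (⟪y, v⟫ * S.indicator (fun _ => (1 : ℝ)) y)) (stdGaussian V) :=
    (hint (-x)).apply_continuousLinearMap v
  refine (congrArg (fun T => T v) h3.fderiv).trans ?_
  rw [setIntegral_add_image_stdGaussian x hS, ← integral_indicator hS]
  have h5 : ∀ y, S.indicator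
      (fun y => Real.exp (⟪-x, y⟫ - ‖x‖ ^ 2 / 2) • ⟪x + y, v⟫) y =
      Real.exp (-‖x‖ ^ 2 / 2) * (⟪x, v⟫ * (Real.exp ⟪-x, y⟫ • S.indicator (fun _ => (1 : ℝ)) y) +
        Real.exp ⟪-x, y⟫ * (⟪y, v⟫ * S.indicator (fun _ => (1 : ℝ)) y)) := by
    intro y
    by_cases hy : y ∈ S
    · simp only [hy, indicator_of_mem, smul_eq_mul, mul_one]
      rw [show ⟪-x, y⟫ - ‖x‖ ^ 2 / 2 = -‖x‖ ^ 2 / 2 + ⟪-x, y⟫ by ring, Real.exp_add, inner_add_left]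
      ring
    · simp [hy]
  simp_rw [h5]
  rw [integral_const_mul, integral_add (hint0.const_mul _) hint1, integral_const_mul]
  simp only [_root_.add_apply, _root_.smul_apply, _root_.neg_apply,
    ContinuousLinearMap.comp_apply, ContinuousLinearMap.coe_id', id, map_neg, h4,
    smul_eq_mul, innerSL_apply_apply, Function.comp]
  ring

end Translates

/-! ### Smoothness, differential and injectivity of `Ψ` -/

section PsiSmooth

variable {q : ℕ}

lemma contDiff_Psi : ContDiff ℝ ∞ (Psi q) := by
  rw [contDiff_euclidean]
  intro i
  exact contDiff_stdGaussian_translate (V := E q)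
    (isOpen_interior (s := {x : E q | ∀ j, x.1 j ≤ x.1 i})).measurableSet

theorem hasFDerivAt_Psi (x : E q) : HasFDerivAt (Psi q)
    ((E q).subtypeL ∘L (-(1 / √2 : ℝ) • L q (modelArea q x))) x := by
  have hd := (contDiff_Psi (q := q)).differentiable (by simp) x
  refine hd.hasFDerivAt.congr_fderiv ?_
  ext v i
  have h1 : fderiv ℝ (Psi q) x v i = fderiv ℝ (fun x => Psi q x i) x v := by
    have := ((EuclideanSpace.proj i : EuclideanSpace ℝ (Fin q) →L[ℝ] ℝ).hasFDerivAt.comp x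
      hd.hasFDerivAt).fderiv
    exact (congrArg (fun T => T v) this).symm
  have h2 := fderiv_stdGaussian_translate (V := E q)
    (isOpen_interior (s := {x : E q | ∀ j, x.1 j ≤ x.1 i})).measurableSet x v
  refine (h1.trans h2).trans ?_
  refine (congrArg Neg.neg (integral_cell_inner x i v)).trans ?_
  have h3 := coord_L (A := modelArea q x) (modelArea_comm x) v i
  change _ = -(1 / √2 : ℝ) * (L q (modelArea q x) v).1 i
  rw [h3]
  ring

lemma isInvertible_L_modelArea (x : E q) : (L q (modelArea q x)).IsInvertible :=
  isInvertible_L fun _ _ => modelArea_pos x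

/-- Along any segment the inner product of `Ψ` with the direction of the segment decreases, since
the differential of `Ψ` is negative definite. -/
lemma Psi_injective : Function.Injective (Psi q) := by
  intro x y hxy
  by_contra hne
  have hv : y - x ≠ 0 := sub_ne_zero.2 (Ne.symm hne)
  set v := y - x with hvdef
  have hder : ∀ t : ℝ, HasDerivAt (fun t : ℝ => ⟪(v : EuclideanSpace ℝ (Fin q)), Psi q (x + t • v)⟫)
      (-(1 / √2) * ⟪L q (modelArea q (x + t • v)) v, v⟫) t := by
    intro t
    have h1 : HasDerivAt (fun t : ℝ => x + t • v) v t := by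
      simpa using ((hasDerivAt_id t).smul_const v).const_add x
    have h2 := (hasFDerivAt_Psi (x + t • v)).comp_hasDerivAt t h1
    have h3 := (innerSL ℝ (v : EuclideanSpace ℝ (Fin q))).hasFDerivAt.comp_hasDerivAt t h2
    refine h3.congr_deriv ?_
    change ⟪(v : EuclideanSpace ℝ (Fin q)),
      -(1 / √2 : ℝ) • (L q (modelArea q (x + t • v)) v : EuclideanSpace ℝ (Fin q))⟫ = _
    rw [inner_smul_right, real_inner_comm, Submodule.coe_inner]
  have hanti := strictAnti_of_deriv_neg fun t => by
    rw [(hder t).deriv]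
    have := inner_L_self_pos (fun i j => modelArea_pos (x + t • v) (i := i) (j := j)) hv
    have h2 : (0 : ℝ) < 1 / √2 := by positivity
    nlinarith
  have h := hanti (zero_lt_one (α := ℝ))
  simp only [zero_smul, add_zero, one_smul, hvdef, add_sub_cancel, hxy] at h
  exact lt_irrefl _ h

lemma PsiInv_Psi (x : E q) : PsiInv q (Psi q x) = x :=
  Function.leftInverse_invFun Psi_injective x

end PsiSmooth

/-! ### The expected maximum and the surjectivity of `Ψ` -/

section ExpectedMax

variable {q : ℕ}

/-- The expectation of `max_i (Y_i - x_i)` for a standard Gaussian vector `Y` on `E`. It is a convex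
function of `x`, whose gradient is `-Ψ`. -/
noncomputable def expMax (q : ℕ) (x : EuclideanSpace ℝ (Fin q)) : ℝ :=
  ∫ y : E q, ⨆ i, (y.1 i - x i) ∂(gauss q)

lemma abs_coord_le (y : EuclideanSpace ℝ (Fin q)) (i : Fin q) : |y i| ≤ ‖y‖ :=
  PiLp.norm_apply_le y i

lemma le_iSup_coord {ι : Type*} [Finite ι] (z : ι → ℝ) (i : ι) : z i ≤ ⨆ i, z i :=
  le_ciSup (Set.finite_range z).bddAbove i

lemma continuous_iSup_coord {X ι : Type*} [TopologicalSpace X] [Finite ι] [Nonempty ι]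
    {f : ι → X → ℝ} (hf : ∀ i, Continuous (f i)) : Continuous fun y => ⨆ i, f i y := by
  have := Fintype.ofFinite ι
  have h : (fun y => ⨆ i, f i y) =
      fun y => Finset.univ.sup' Finset.univ_nonempty fun i => f i y := by
    ext y
    exact (Finset.sup'_univ_eq_ciSup _).symm
  rw [h]
  exact Continuous.finset_sup'_apply _ fun i _ => hf i

lemma abs_iSup_le {ι : Type*} [Finite ι] [Nonempty ι] {z : ι → ℝ} {C : ℝ} (h : ∀ i, |z i| ≤ C) :
    |⨆ i, z i| ≤ C := by
  obtain ⟨i⟩ := ‹Nonempty ι›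
  exact abs_le.2 ⟨(neg_le_of_abs_le (h i)).trans (le_iSup_coord z i),
    ciSup_le fun i => le_of_abs_le (h i)⟩

lemma integrable_norm_gauss : Integrable (fun y : E q => ‖y‖) (gauss q) :=
  integrable_norm_stdGaussian

lemma abs_coord_E_le (y : E q) (i : Fin q) : |y.1 i| ≤ ‖y‖ := abs_coord_le y.1 i

lemma integrable_coord (i : Fin q) : Integrable (fun y : E q => y.1 i) (gauss q) :=
  integrable_norm_gauss.mono' (continuous_coord i).aestronglyMeasurable
    (ae_of_all _ fun y => abs_coord_E_le y i)

lemma integral_coord (i : Fin q) : ∫ y : E q, y.1 i ∂(gauss q) = 0 := by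
  have h := integral_strongDual_stdGaussian
    ((EuclideanSpace.proj i : EuclideanSpace ℝ (Fin q) →L[ℝ] ℝ).comp (E q).subtypeL)
  exact h

lemma integrable_iSup_coord {ι : Type*} [Finite ι] [Nonempty ι] (σ : ι → Fin q) (x : ι → ℝ) :
    Integrable (fun y : E q => ⨆ k, (y.1 (σ k) - x k)) (gauss q) := by
  obtain ⟨C, hC⟩ := (Set.finite_range fun k => |x k|).bddAbove
  refine (integrable_norm_gauss.add (integrable_const C)).mono'
    (continuous_iSup_coord fun k => (continuous_coord (σ k)).sub
      continuous_const).aestronglyMeasurable (ae_of_all _ fun y => abs_iSup_le fun k => ?_)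
  exact (abs_sub _ _).trans (add_le_add (abs_coord_E_le y _) (hC ⟨k, rfl⟩))

lemma integrable_iSup_sub [Nonempty (Fin q)] (x : EuclideanSpace ℝ (Fin q)) :
    Integrable (fun y : E q => ⨆ i, (y.1 i - x i)) (gauss q) :=
  integrable_iSup_coord id x

lemma neg_inner_le_expMax [Nonempty (Fin q)] {p : EuclideanSpace ℝ (Fin q)} (hp : p ∈ simplex q)
    (x : EuclideanSpace ℝ (Fin q)) : -⟪p, x⟫ ≤ expMax q x := by
  have hint : ∀ i, Integrable (fun y : E q => p i * (y.1 i - x i)) (gauss q) := fun i =>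
    ((integrable_coord i).sub (integrable_const _)).const_mul _
  have h1 : ∫ y : E q, ∑ i, p i * (y.1 i - x i) ∂(gauss q) = -⟪p, x⟫ := by
    rw [integral_finsetSum _ fun i _ => hint i]
    simp_rw [integral_const_mul]
    rw [PiLp.inner_apply, ← Finset.sum_neg_distrib]
    refine Finset.sum_congr rfl fun i _ => ?_
    rw [integral_sub (integrable_coord i) (integrable_const _), integral_coord]
    simp [mul_comm]
  rw [← h1]
  refine integral_mono (integrable_finsetSum _ fun i _ => hint i) (integrable_iSup_sub x)
    fun y => ?_
  calc ∑ i, p i * (y.1 i - x i) ≤ ∑ i, p i * ⨆ i, (y.1 i - x i) :=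
        Finset.sum_le_sum fun i _ => mul_le_mul_of_nonneg_left
          (le_iSup_coord (fun i => y.1 i - x i) i) (hp.1 i)
    _ = _ := by rw [← Finset.sum_mul, hp.2, one_mul]

lemma iSup_eq_of_mem_cell {x y : E q} {i : Fin q} (hy : y ∈ shift x (modelCell q i)) :
    ⨆ j, (y.1 j - x.1 j) = y.1 i - x.1 i := by
  have : Nonempty (Fin q) := ⟨i⟩
  refine le_antisymm (ciSup_le fun j => ?_) (le_iSup_coord (fun j => y.1 j - x.1 j) i)
  rcases eq_or_ne j i with rfl | hj
  · exact le_rfl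
  · rw [shift_modelCell] at hy
    linarith [hy j hj]

/-- `-Ψ(x)` is a subgradient of `expMax` at `x`. -/
lemma expMax_sub_le [Nonempty (Fin q)] (x : E q) (x' : EuclideanSpace ℝ (Fin q)) :
    expMax q x - ⟪Psi q x, x' - x⟫ ≤ expMax q x' := by
  have hq : 1 ≤ q := (Classical.arbitrary (Fin q)).pos
  have hint : Integrable (fun y : E q => (⨆ j, (y.1 j - x.1 j)) - ⨆ j, (y.1 j - x' j)) (gauss q) :=
    (integrable_iSup_sub x.1).sub (integrable_iSup_sub x')
  rw [sub_le_iff_le_add, ← sub_le_iff_le_add', expMax, expMax,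
    ← integral_sub (integrable_iSup_sub _) (integrable_iSup_sub _),
    integral_eq_sum_cells hq x hint, PiLp.inner_apply]
  refine Finset.sum_le_sum fun i _ => ?_
  have hm := (isOpen_shift_modelCell x i).measurableSet
  calc ∫ y in shift x (modelCell q i), ((⨆ j, (y.1 j - x.1 j)) - ⨆ j, (y.1 j - x' j)) ∂(gauss q)
      ≤ ∫ y in shift x (modelCell q i), (x' i - x.1 i) ∂(gauss q) := by
        refine setIntegral_mono_on hint.integrableOn
          (integrable_const _).integrableOn hm fun y hy => ?_
        rw [iSup_eq_of_mem_cell hy]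
        linarith [le_iSup_coord (fun j => y.1 j - x' j) i]
    _ = _ := by
        rw [setIntegral_const, smul_eq_mul, ← Psi_apply, mul_comm]
        rfl

/-- The total area of the interfaces, by the first moments of the cells. -/
lemma expMax_add_inner (hq : 1 ≤ q) (x : E q) : expMax q x + ⟪Psi q x, (x : EuclideanSpace ℝ (Fin q))⟫ =
    √2 * ∑ i, ∑ j with i < j, modelArea q x i j := by
  have : Nonempty (Fin q) := ⟨⟨0, hq⟩⟩
  have h1 : ∀ i, ∫ y in shift x (modelCell q i), ⨆ j, (y.1 j - x.1 j) ∂(gauss q) =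
      (1 / √2) * (∑ j with j ≠ i, modelArea q x i j) - Psi q x i * x.1 i := by
    intro i
    have hm := (isOpen_shift_modelCell x i).measurableSet
    rw [setIntegral_congr_fun hm fun y hy => iSup_eq_of_mem_cell hy,
      integral_sub (integrable_coord i).integrableOn (integrable_const _).integrableOn,
      setIntegral_const, ← Psi_apply, smul_eq_mul]
    congr 1
    have h2 := integral_cell_inner x i (-dualVec q i)
    have h3 : ∀ y : E q, ⟪y, -dualVec q i⟫ = y.1 i := fun y => by
      rw [inner_neg_right, Submodule.coe_inner, PiLp.inner_apply]
      simp only [coord_dualVec]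
      simp [sub_mul, Finset.sum_sub_distrib, ← Finset.mul_sum, sum_coord_eq_zero]
    simp_rw [h3] at h2
    rw [h2, Finset.sum_filter]
    congr 1
    refine Finset.sum_congr rfl fun j _ => ?_
    simp only [Submodule.coe_neg, PiLp.neg_apply, coord_dualVec, if_true]
    rcases eq_or_ne j i with rfl | hj
    · simp
    · simp [hj]
  rw [expMax, integral_eq_sum_cells hq x (integrable_iSup_sub _), PiLp.inner_apply]
  simp_rw [h1]
  rw [Finset.sum_sub_distrib, ← Finset.mul_sum, sum_ne_eq_two_mul_sum_lt (modelArea_comm x)]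
  have h6 : ∑ i, Psi q x i * x.1 i = ∑ i, ⟪Psi q x i, x.1 i⟫ :=
    Finset.sum_congr rfl fun i _ => by simp [mul_comm]
  have h7 : (√2 : ℝ) * √2 = 2 := Real.mul_self_sqrt (by norm_num)
  rw [h6, sub_add_cancel, ← mul_assoc]
  congr 1
  field_simp
  rw [sq, h7]

lemma expMax_le_add_norm [Nonempty (Fin q)] (x x' : EuclideanSpace ℝ (Fin q)) :
    expMax q x ≤ expMax q x' + ‖x - x'‖ := by
  have h : expMax q x' + ‖x - x'‖ =
      ∫ y : E q, ((⨆ i, (y.1 i - x' i)) + ‖x - x'‖) ∂(gauss q) := by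
    rw [integral_add (integrable_iSup_sub _) (integrable_const _), expMax]
    simp
  rw [h, expMax]
  refine integral_mono (integrable_iSup_sub x)
    ((integrable_iSup_sub x').add (integrable_const _)) fun y => ciSup_le fun i => ?_
  have h1 := le_iSup_coord (fun j => y.1 j - x' j) i
  have h2 := neg_le_of_abs_le (abs_coord_le (x - x') i)
  simp only [PiLp.sub_apply] at h1 h2 ⊢
  linarith

lemma continuous_expMax [Nonempty (Fin q)] : Continuous (expMax q) := by
  refine (LipschitzWith.of_le_add_mul 1 fun x x' => ?_).continuous
  rw [NNReal.coe_one, one_mul, dist_eq_norm]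
  exact expMax_le_add_norm x x'

/-- Coercivity of `x ↦ expMax x + ⟪v, x⟫` on `E`, for `v` in the interior of the simplex. -/
lemma exists_pos_mul_norm_le (hq : 1 ≤ q) {v : EuclideanSpace ℝ (Fin q)}
    (hv : v ∈ simplexInterior q) :
    ∃ c > 0, ∀ x : E q, c * ‖x‖ ≤ expMax q x + ⟪v, (x : EuclideanSpace ℝ (Fin q))⟫ := by
  have : Nonempty (Fin q) := ⟨⟨0, hq⟩⟩
  obtain ⟨i₀, hi₀⟩ := Finite.exists_min fun i => v i
  set ε := v i₀ with hε
  have hε0 : 0 < ε := hv.1 i₀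
  -- Moving the mass `ε` from the `k`-th coordinate of `v` to the `j`-th one stays in the simplex.
  have h1 : ∀ (x : E q) (j k : Fin q),
      ε * (x.1 k - x.1 j) ≤ expMax q x + ⟪v, (x : EuclideanSpace ℝ (Fin q))⟫ := by
    intro x j k
    have hp : v + ε • (EuclideanSpace.single j 1 - EuclideanSpace.single k 1) ∈ simplex q := by
      refine ⟨fun i => ?_, ?_⟩
      · have h1 := hi₀ i
        have h2 : 0 ≤ (EuclideanSpace.single j (1 : ℝ)) i := by
          simp only [PiLp.single_apply]; split_ifs <;> norm_num
        have h3 : (EuclideanSpace.single k (1 : ℝ)) i ≤ 1 := by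
          simp only [PiLp.single_apply]; split_ifs <;> norm_num
        simp only [PiLp.add_apply, PiLp.smul_apply, PiLp.sub_apply, smul_eq_mul]
        nlinarith
      · simp [Finset.sum_add_distrib, ← Finset.mul_sum, Finset.sum_sub_distrib, hv.2]
    have h2 := neg_inner_le_expMax hp x
    rw [inner_add_left, real_inner_smul_left, inner_sub_left, EuclideanSpace.inner_single_left,
      EuclideanSpace.inner_single_left] at h2
    simp only [map_one, one_mul] at h2
    linarith
  set D : ℝ := ∑ j, ‖dualVec q j‖
  have hD : 0 ≤ D := Finset.sum_nonneg fun j _ => norm_nonneg _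
  refine ⟨ε / (D + 1), by positivity, fun x => ?_⟩
  set F := expMax q x + ⟪v, (x : EuclideanSpace ℝ (Fin q))⟫
  have hF : 0 ≤ F := by simpa using h1 x i₀ i₀
  have hx : ε * ‖x‖ ≤ F * D := by
    conv_lhs => rw [← sum_smul_dualVec i₀ x]
    calc ε * ‖∑ j, (x.1 i₀ - x.1 j) • dualVec q j‖
        ≤ ε * ∑ j, ‖(x.1 i₀ - x.1 j) • dualVec q j‖ := by gcongr; exact norm_sum_le _ _
      _ ≤ F * D := by
        rw [Finset.mul_sum, Finset.mul_sum]
        refine Finset.sum_le_sum fun j _ => ?_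
        rw [norm_smul, ← mul_assoc]
        refine mul_le_mul_of_nonneg_right ?_ (norm_nonneg _)
        rw [← Real.norm_of_nonneg hε0.le, ← norm_mul, Real.norm_eq_abs]
        exact abs_le.2 ⟨by linarith [h1 x i₀ j], h1 x j i₀⟩
  rw [div_mul_eq_mul_div, div_le_iff₀ (by positivity)]
  linarith

/-- Surjectivity of `Ψ`: the minimizer of the coercive convex function `expMax + ⟪v, ·⟫` on `E` is a
preimage of `v`. -/
lemma exists_Psi_eq (hq : 1 ≤ q) {v : EuclideanSpace ℝ (Fin q)} (hv : v ∈ simplexInterior q) :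
    ∃ x, Psi q x = v := by
  have : Nonempty (Fin q) := ⟨⟨0, hq⟩⟩
  obtain ⟨c, hc, hcoer⟩ := exists_pos_mul_norm_le hq hv
  have hcont : Continuous fun x : E q => expMax q x + ⟪v, (x : EuclideanSpace ℝ (Fin q))⟫ :=
    (continuous_expMax.comp continuous_subtype_val).add
      (continuous_const.inner continuous_subtype_val)
  obtain ⟨x, hx⟩ := hcont.exists_forall_le (tendsto_atTop_mono hcoer
    ((tendsto_norm_cocompact_atTop (E := E q)).const_mul_atTop hc))
  refine ⟨x, ?_⟩
  have hnn : ∀ h : E q, 0 ≤ ⟪v - Psi q x, (h : EuclideanSpace ℝ (Fin q))⟫ := by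
    intro h
    have hlim : Tendsto (fun t : ℝ => ⟪v - Psi q (x + t • h), (h : EuclideanSpace ℝ (Fin q))⟫)
        (𝓝[>] 0) (𝓝 ⟪v - Psi q x, (h : EuclideanSpace ℝ (Fin q))⟫) := by
      have hc : Continuous fun t : ℝ => ⟪v - Psi q (x + t • h), (h : EuclideanSpace ℝ (Fin q))⟫ :=
        (continuous_const.sub (contDiff_Psi.continuous.comp (by fun_prop))).inner continuous_const
      exact (hc.tendsto' 0 _ (by simp)).mono_left nhdsWithin_le_nhds
    refine ge_of_tendsto hlim ?_
    filter_upwards [self_mem_nhdsWithin] with t ht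
    have ht : 0 < t := ht
    have h1 := hx (x + t • h)
    have h2 := expMax_sub_le (x + t • h) (x : EuclideanSpace ℝ (Fin q))
    have e : (x : EuclideanSpace ℝ (Fin q)) - ((x + t • h : E q) : EuclideanSpace ℝ (Fin q)) =
        -(t • (h : EuclideanSpace ℝ (Fin q))) := by
      rw [Submodule.coe_add, Submodule.coe_smul]; abel
    rw [e, inner_neg_right, inner_smul_right] at h2
    have e2 : ((x + t • h : E q) : EuclideanSpace ℝ (Fin q)) = x + t • (h : EuclideanSpace ℝ (Fin q)) :=
      rfl
    rw [e2, inner_add_right, inner_smul_right] at h1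
    have h3 : 0 ≤ t * ⟪v - Psi q (x + t • h), (h : EuclideanSpace ℝ (Fin q))⟫ := by
      rw [inner_sub_left, mul_sub]
      rw [e2] at h2
      linarith
    exact nonneg_of_mul_nonneg_right h3 ht
  have hmem : Psi q x - v ∈ E q := by
    change ∑ i, (Psi q x - v) i = 0
    simp only [PiLp.sub_apply, Finset.sum_sub_distrib, sum_Psi hq, hv.2, sub_self]
  have h := hnn ⟨_, hmem⟩
  rw [← neg_sub, inner_neg_left, neg_nonneg, real_inner_self_nonpos] at h
  exact sub_eq_zero.1 h

lemma bijOn_Psi (hq : 1 ≤ q) : BijOn (Psi q) univ (simplexInterior q) :=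
  ⟨fun x _ => Psi_mem_simplexInterior hq x, Psi_injective.injOn, fun _ hv =>
    (exists_Psi_eq hq hv).imp fun _ h => ⟨mem_univ _, h⟩⟩

lemma Psi_PsiInv (hq : 1 ≤ q) {v : EuclideanSpace ℝ (Fin q)} (hv : v ∈ simplexInterior q) :
    Psi q (PsiInv q v) = v :=
  Function.invFun_eq (exists_Psi_eq hq hv)

end ExpectedMax

/-! ### The inverse of `Ψ` -/

section Inverse

variable {q : ℕ}

lemma sub_mem_E {v v' : EuclideanSpace ℝ (Fin q)} (hv : ∑ i, v i = 1) (hv' : ∑ i, v' i = 1) :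
    v' - v ∈ E q := by
  change ∑ i, (v' - v) i = 0
  simp only [PiLp.sub_apply, Finset.sum_sub_distrib, hv, hv', sub_self]

lemma eventually_add_mem_simplexInterior {v : EuclideanSpace ℝ (Fin q)}
    (hv : v ∈ simplexInterior q) : ∀ᶠ w : E q in 𝓝 0, v + (w : EuclideanSpace ℝ (Fin q)) ∈
      simplexInterior q := by
  have h1 : ∀ᶠ w : E q in 𝓝 0, ∀ i, 0 < v i + w.1 i := by
    refine eventually_all.2 fun i => ?_
    have hc : Continuous fun w : E q => v i + w.1 i := by fun_prop
    refine (hc.tendsto 0).eventually (lt_mem_nhds ?_)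
    simpa using hv.1 i
  filter_upwards [h1] with w hw
  refine ⟨fun i => hw i, ?_⟩
  simp only [PiLp.add_apply, Finset.sum_add_distrib, hv.2, sum_coord_eq_zero, add_zero]

/-- The inverse of `Ψ` is smooth, with the differential given by the inverse function theorem. The
map `x ↦ -√2 (Ψ(x) - v)` is used since its differential is exactly `L_A`. -/
lemma PsiInv_add (hq : 1 ≤ q) {v : EuclideanSpace ℝ (Fin q)} (hv : v ∈ simplexInterior q) :
    ContDiffAt ℝ ∞ (fun w : E q => PsiInv q (v + w)) 0 ∧
      HasFDerivAt (fun w : E q => PsiInv q (v + w))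
        (-(√2 : ℝ) • (L q (modelArea q (PsiInv q v))).inverse) 0 := by
  set x := PsiInv q v with hxdef
  have hx : Psi q x = v := Psi_PsiInv hq hv
  obtain ⟨e, he⟩ := isInvertible_L_modelArea x
  set P := (E q).orthogonalProjectionOnto
  let Θ : E q → E q := fun z => -(√2 : ℝ) • P (Psi q z - v)
  have hΘ : ContDiffAt ℝ ∞ Θ x :=
    have h : ContDiff ℝ ∞ fun z => P (Psi q z - v) :=
      P.contDiff.comp (contDiff_Psi.sub contDiff_const)
    (h.const_smul _).contDiffAt
  have h2 : (√2 : ℝ) ≠ 0 := by positivity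
  have hP : ∀ z : E q, P (z : EuclideanSpace ℝ (Fin q)) = z := fun z =>
    Submodule.orthogonalProjectionOnto_mem_subspace_eq_self z
  have hΘ' : HasFDerivAt Θ (e : E q →L[ℝ] E q) x := by
    have h := (P.hasFDerivAt.comp x ((hasFDerivAt_Psi x).sub_const v)).const_smul (-(√2 : ℝ))
    refine h.congr_fderiv ?_
    ext1 z
    change -(√2 : ℝ) • P ((-(1 / √2 : ℝ) • L q (modelArea q x) z : E q) :
      EuclideanSpace ℝ (Fin q)) = e z
    rw [hP, smul_smul, ← he]
    have : -(√2 : ℝ) * -(1 / √2) = 1 := by field_simp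
    rw [this, one_smul]
    rfl
  have hΘx : Θ x = 0 := by
    simp only [Θ, hx, sub_self, map_zero, smul_zero]
  have hstrict : HasStrictFDerivAt Θ (e : E q →L[ℝ] E q) x :=
    hΘ.hasStrictFDerivAt' hΘ' (by simp)
  set g := hstrict.localInverse Θ e x
  have hg : ContDiffAt ℝ ∞ g 0 := by
    have := hΘ.to_localInverse hΘ' (by simp)
    rw [hΘx] at this
    exact this
  have hg' : HasFDerivAt g (e.symm : E q →L[ℝ] E q) 0 := by
    have := hstrict.to_localInverse.hasFDerivAt
    rwa [hΘx] at this
  have hright : ∀ᶠ w in 𝓝 (0 : E q), Θ (g w) = w := by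
    have := hstrict.eventually_right_inverse
    rwa [hΘx] at this
  have hlin : HasFDerivAt (fun w : E q => -(√2 : ℝ) • w)
      (-(√2 : ℝ) • ContinuousLinearMap.id ℝ (E q)) 0 :=
    (-(√2 : ℝ) • ContinuousLinearMap.id ℝ (E q)).hasFDerivAt
  have hev : (fun w : E q => PsiInv q (v + w)) =ᶠ[𝓝 0] fun w => g (-(√2 : ℝ) • w) := by
    have ht : Tendsto (fun w : E q => -(√2 : ℝ) • w) (𝓝 0) (𝓝 0) :=
      (continuous_const_smul _).tendsto' _ _ (smul_zero _)
    filter_upwards [ht.eventually hright] with w hw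
    have h3 : P (Psi q (g (-(√2 : ℝ) • w)) - v) = w := by
      have : -(√2 : ℝ) ≠ 0 := neg_ne_zero.2 h2
      exact smul_right_injective (E q) this hw
    have hm := sub_mem_E hv.2 (sum_Psi hq (g (-(√2 : ℝ) • w)))
    have h4 : P (Psi q (g (-(√2 : ℝ) • w)) - v) = ⟨_, hm⟩ := hP ⟨_, hm⟩
    have h5 : Psi q (g (-(√2 : ℝ) • w)) - v = w := by
      rw [h4] at h3
      exact congrArg Subtype.val h3
    rw [← h5, add_sub_cancel, PsiInv_Psi]
  constructor
  · refine ContDiffAt.congr_of_eventuallyEq ?_ hev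
    refine ContDiffAt.comp (g := g) (0 : E q) ?_ (contDiff_id.const_smul _).contDiffAt
    simpa using hg
  · refine HasFDerivAt.congr_of_eventuallyEq ?_ hev
    have h6 : HasFDerivAt g (e.symm : E q →L[ℝ] E q) (-(√2 : ℝ) • (0 : E q)) := by
      rwa [smul_zero]
    refine (h6.comp 0 hlin).congr_fderiv ?_
    rw [← he, ContinuousLinearMap.inverse_equiv]
    ext1 z
    change e.symm (-(√2 : ℝ) • z) = -(√2 : ℝ) • e.symm z
    rw [map_smul]

end Inverse

/-! ### Gradient and Hessian of the model profile -/

section Profile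

variable {q : ℕ}

lemma modelProfile_eq (hq : 1 ≤ q) {v : EuclideanSpace ℝ (Fin q)} (hv : v ∈ simplexInterior q) :
    modelProfile q v = (1 / √2) *
      (expMax q (PsiInv q v) + ⟪v, (PsiInv q v : EuclideanSpace ℝ (Fin q))⟫) := by
  have h := expMax_add_inner hq (PsiInv q v)
  rw [Psi_PsiInv hq hv] at h
  have h2 : (√2 : ℝ) ≠ 0 := by positivity
  rw [h, ← mul_assoc, one_div_mul_cancel h2, one_mul, modelProfile, clusterPerimeter_cells,
    ENNReal.toReal_sum fun i _ => (ENNReal.sum_lt_top.2 fun j hj =>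
      gaussSurface_interface_lt_top _ (Finset.mem_filter.1 hj).2.ne).ne]
  refine Finset.sum_congr rfl fun i _ => ?_
  rw [ENNReal.toReal_sum fun j hj =>
    (gaussSurface_interface_lt_top _ (Finset.mem_filter.1 hj).2.ne).ne]
  rfl

/-- The tangent planes of `√2 I_m` lie above its graph. -/
lemma modelProfile_le (hq : 1 ≤ q) {v : EuclideanSpace ℝ (Fin q)} (hv : v ∈ simplexInterior q)
    (x : EuclideanSpace ℝ (Fin q)) : modelProfile q v ≤ (1 / √2) * (expMax q x + ⟪v, x⟫) := by
  have : Nonempty (Fin q) := ⟨⟨0, hq⟩⟩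
  rw [modelProfile_eq hq hv]
  have h := expMax_sub_le (PsiInv q v) x
  rw [Psi_PsiInv hq hv, inner_sub_right] at h
  refine mul_le_mul_of_nonneg_left ?_ (by positivity)
  linarith

lemma modelProfile_sub_le (hq : 1 ≤ q) {v v' : EuclideanSpace ℝ (Fin q)}
    (hv : v ∈ simplexInterior q) (hv' : v' ∈ simplexInterior q) :
    modelProfile q v' - modelProfile q v ≤
      (1 / √2) * ⟪(PsiInv q v : EuclideanSpace ℝ (Fin q)), v' - v⟫ := by
  have h := modelProfile_le hq hv' (PsiInv q v)
  rw [modelProfile_eq hq hv, real_inner_comm (v' - v), inner_sub_left]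
  linarith

/-- The gradient of `I_m`: the increments of `I_m` between `v` and `v'` lie between those of its
tangent planes at `v` and at `v'`, and `Ψ⁻¹` is continuous. -/
lemma hasGradientAt_modelProfile_zero (hq : 1 ≤ q) {v : EuclideanSpace ℝ (Fin q)}
    (hv : v ∈ simplexInterior q) :
    HasGradientAt (fun w : E q => modelProfile q (v + w)) ((1 / √2 : ℝ) • PsiInv q v) 0 := by
  rw [hasGradientAt_iff_isLittleO, Asymptotics.isLittleO_iff]
  intro c hc
  have hcont : Tendsto (fun w : E q => PsiInv q (v + w)) (𝓝 0) (𝓝 (PsiInv q v)) := by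
    have := (PsiInv_add hq hv).1.continuousAt.tendsto
    simpa using this
  have hball := hcont.eventually (Metric.ball_mem_nhds (PsiInv q v) hc)
  have h2 : (0 : ℝ) < 1 / √2 := by positivity
  have h2' : (1 : ℝ) / √2 ≤ 1 := by
    rw [div_le_one (by positivity)]
    exact Real.one_le_sqrt.2 (by norm_num)
  filter_upwards [eventually_add_mem_simplexInterior hv, hball] with w hw hb
  have h3 := modelProfile_sub_le hq hv hw
  have h4 := modelProfile_sub_le hq hw hv
  rw [add_sub_cancel_left] at h3
  rw [show v - (v + w) = -(w : EuclideanSpace ℝ (Fin q)) by abel, inner_neg_right] at h4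
  have hb' : ‖PsiInv q (v + w) - PsiInv q v‖ ≤ c := (mem_ball_iff_norm.1 hb).le
  have h5 := abs_real_inner_le_norm (PsiInv q (v + w) - PsiInv q v) w
  rw [inner_sub_left (PsiInv q (v + w)) (PsiInv q v) w] at h5
  have h6 : ‖PsiInv q (v + w) - PsiInv q v‖ * ‖w‖ ≤ c * ‖w‖ := by gcongr
  have h7 := neg_le_of_abs_le (h5.trans h6)
  have h8 : ⟪(1 / √2 : ℝ) • PsiInv q v, w - 0⟫ = (1 / √2) * ⟪PsiInv q v, w⟫ := by
    rw [sub_zero, real_inner_smul_left (PsiInv q v) w]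
  rw [h8, sub_zero, Submodule.coe_zero, add_zero, Real.norm_eq_abs, abs_le]
  have h9 : (0 : ℝ) ≤ c * ‖w‖ := by positivity
  simp only [Submodule.coe_inner] at h7 ⊢
  constructor <;> nlinarith

lemma hasGradientAt_modelProfile (hq : 1 ≤ q) (v : EuclideanSpace ℝ (Fin q)) {w : E q}
    (hv : v + w ∈ simplexInterior q) :
    HasGradientAt (fun w : E q => modelProfile q (v + w)) ((1 / √2 : ℝ) • PsiInv q (v + w)) w := by
  have h := (hasGradientAt_modelProfile_zero hq hv).hasFDerivAt
  rw [← sub_self w] at h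
  have hs : HasFDerivAt (fun z : E q => z - w) (ContinuousLinearMap.id ℝ (E q)) w :=
    (hasFDerivAt_id w).sub_const w
  have h1 := HasFDerivAt.comp (f := fun z : E q => z - w) w h hs
  rw [hasGradientAt_iff_hasFDerivAt]
  refine (h1.congr_fderiv (ContinuousLinearMap.comp_id _)).congr_of_eventuallyEq
    (Eventually.of_forall fun z => ?_)
  change modelProfile q (v + z) = modelProfile q (v + w + ((z - w : E q) : EuclideanSpace ℝ (Fin q)))
  rw [Submodule.coe_sub]
  congr 1
  abel

lemma contDiffAt_modelProfile (hq : 1 ≤ q) {v : EuclideanSpace ℝ (Fin q)}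
    (hv : v ∈ simplexInterior q) :
    ContDiffAt ℝ ∞ (fun w : E q => modelProfile q (v + w)) 0 := by
  rw [contDiffAt_infty]
  intro n
  refine ContDiffAt.of_le (n := (n : WithTop ℕ∞) + 1) ?_ le_self_add
  rw [contDiffAt_succ_iff_hasFDerivAt]
  refine ⟨fun w => innerSL ℝ ((1 / √2 : ℝ) • PsiInv q (v + w)),
    ⟨_, eventually_add_mem_simplexInterior hv, fun w hw => ?_⟩, ?_⟩
  · exact (hasGradientAt_modelProfile hq v hw).hasFDerivAt
  · exact (innerSL ℝ).contDiff.contDiffAt.comp 0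
      (((PsiInv_add hq hv).1.of_le (by exact_mod_cast le_top)).const_smul _)

lemma hasFDerivAt_gradient_modelProfile (hq : 1 ≤ q) {v : EuclideanSpace ℝ (Fin q)}
    (hv : v ∈ simplexInterior q) :
    HasFDerivAt (gradient fun w : E q => modelProfile q (v + w))
      (-(L q (modelArea q (PsiInv q v))).inverse) 0 := by
  have h := (PsiInv_add hq hv).2.const_smul (1 / √2 : ℝ)
  refine (h.congr_fderiv ?_).congr_of_eventuallyEq ?_
  · have h2 : (1 / √2 : ℝ) * -√2 = -1 := by
      have : (√2 : ℝ) ≠ 0 := by positivity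
      field_simp
    rw [smul_smul, h2, neg_one_smul]
  · filter_upwards [eventually_add_mem_simplexInterior hv] with w hw
    exact (hasGradientAt_modelProfile hq v hw).gradient

end Profile

/-! ### The continuous extension of the profile to the simplex -/

section Envelope

variable {q : ℕ}

/-- The concave conjugate `inf_x (expMax x + ⟪v, x⟫)` of `expMax`. On the interior of the simplex it
is `√2` times the model profile. -/
noncomputable def expMaxEnvelope (q : ℕ) (v : EuclideanSpace ℝ (Fin q)) : ℝ :=
  ⨅ x : EuclideanSpace ℝ (Fin q), (expMax q x + ⟪v, x⟫)

lemma expMax_add_inner_nonneg [Nonempty (Fin q)] {v : EuclideanSpace ℝ (Fin q)}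
    (hv : v ∈ simplex q) (x : EuclideanSpace ℝ (Fin q)) : 0 ≤ expMax q x + ⟪v, x⟫ := by
  linarith [neg_inner_le_expMax hv x]

lemma expMaxEnvelope_le [Nonempty (Fin q)] {v : EuclideanSpace ℝ (Fin q)} (hv : v ∈ simplex q)
    (x : EuclideanSpace ℝ (Fin q)) : expMaxEnvelope q v ≤ expMax q x + ⟪v, x⟫ :=
  ciInf_le ⟨0, by rintro _ ⟨x, rfl⟩; exact expMax_add_inner_nonneg hv x⟩ x

lemma simplexInterior_subset : simplexInterior q ⊆ simplex q :=
  fun _ hv => ⟨fun i => (hv.1 i).le, hv.2⟩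

lemma modelProfile_eq_expMaxEnvelope (hq : 1 ≤ q) {v : EuclideanSpace ℝ (Fin q)}
    (hv : v ∈ simplexInterior q) : (1 / √2) * expMaxEnvelope q v = modelProfile q v := by
  have : Nonempty (Fin q) := ⟨⟨0, hq⟩⟩
  refine le_antisymm ?_ ?_
  · rw [modelProfile_eq hq hv]
    exact mul_le_mul_of_nonneg_left (expMaxEnvelope_le (simplexInterior_subset hv) _)
      (by positivity)
  · have h2 : (0 : ℝ) < 1 / √2 := by positivity
    rw [← div_le_iff₀' h2]
    refine le_ciInf fun x => ?_
    rw [div_le_iff₀' h2]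
    exact modelProfile_le hq hv x

/-- A quantitative form of lower semicontinuity: `v` is a convex combination of `v₀`, with weight
`t`, and of another point of the simplex, where the concave envelope is nonnegative. -/
lemma mul_expMaxEnvelope_le [Nonempty (Fin q)] {v v₀ : EuclideanSpace ℝ (Fin q)}
    (hv : v ∈ simplex q) (hv₀ : v₀ ∈ simplex q) {t : ℝ} (ht0 : 0 ≤ t) (ht1 : t < 1)
    (h : ∀ i, t * v₀ i ≤ v i) : t * expMaxEnvelope q v₀ ≤ expMaxEnvelope q v := by
  refine le_ciInf fun x => ?_
  have ht : 0 < 1 - t := by linarith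
  have hp : (1 - t)⁻¹ • (v - t • v₀) ∈ simplex q := by
    refine ⟨fun i => ?_, ?_⟩
    · simp only [PiLp.smul_apply, PiLp.sub_apply, smul_eq_mul]
      exact mul_nonneg (by positivity) (by linarith [h i])
    · simp only [PiLp.smul_apply, PiLp.sub_apply, smul_eq_mul, ← Finset.mul_sum,
        Finset.sum_sub_distrib, hv.2, hv₀.2]
      field_simp
  have h1 := expMax_add_inner_nonneg hp x
  have h2 := expMaxEnvelope_le hv₀ x
  rw [real_inner_smul_left, inner_sub_left, real_inner_smul_left] at h1
  have h3 : 0 ≤ (1 - t) * expMax q x + (⟪v, x⟫ - t * ⟪v₀, x⟫) := by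
    have := mul_nonneg ht.le h1
    rwa [mul_add, mul_inv_cancel_left₀ ht.ne'] at this
  nlinarith

lemma continuousOn_expMaxEnvelope [Nonempty (Fin q)] :
    ContinuousOn (expMaxEnvelope q) (simplex q) := by
  intro v₀ hv₀
  refine tendsto_order.2 ⟨fun a ha => ?_, fun a ha => ?_⟩
  · have hlim : Tendsto (fun t : ℝ => t * expMaxEnvelope q v₀) (𝓝[<] 1)
        (𝓝 (expMaxEnvelope q v₀)) :=
      ((continuous_mul_const _).tendsto' 1 _ (one_mul _)).mono_left nhdsWithin_le_nhds
    obtain ⟨t, ⟨hta, ht1⟩, ht0⟩ := (((hlim.eventually (lt_mem_nhds ha)).and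
      self_mem_nhdsWithin).and (mem_nhdsWithin_of_mem_nhds (lt_mem_nhds zero_lt_one))).exists
    have ht1 : t < 1 := ht1
    have ht0 : 0 < t := ht0
    have hev : ∀ᶠ v in 𝓝[simplex q] v₀, ∀ i, t * v₀ i ≤ v i := by
      refine eventually_all.2 fun i => ?_
      rcases (hv₀.1 i).eq_or_lt with h0 | h0
      · filter_upwards [self_mem_nhdsWithin] with v hv
        rw [← h0, mul_zero]
        exact hv.1 i
      · have hc : Continuous fun v : EuclideanSpace ℝ (Fin q) => v i := by fun_prop
        have hlt : t * v₀ i < v₀ i := by nlinarith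
        filter_upwards [mem_nhdsWithin_of_mem_nhds
          ((hc.tendsto v₀).eventually (lt_mem_nhds hlt))] with v hv
        exact hv.le
    filter_upwards [hev, self_mem_nhdsWithin] with v hv hvs
    exact hta.trans_le (mul_expMaxEnvelope_le hvs hv₀ ht0.le ht1 hv)
  · obtain ⟨x, hx⟩ := exists_lt_of_ciInf_lt ha
    have hc : Continuous fun v : EuclideanSpace ℝ (Fin q) => expMax q x + ⟪v, x⟫ := by fun_prop
    filter_upwards [self_mem_nhdsWithin, mem_nhdsWithin_of_mem_nhds
      ((hc.tendsto v₀).eventually (gt_mem_nhds hx))] with v hv hvx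
    exact (expMaxEnvelope_le hv x).trans_lt hvx

end Envelope

/-! ### The extension on the faces -/

section Faces

/-- The image of a standard Gaussian measure under the adjoint of an isometric embedding. -/
lemma map_adjoint_stdGaussian {V W : Type*} [NormedAddCommGroup V] [InnerProductSpace ℝ V]
    [FiniteDimensional ℝ V] [MeasurableSpace V] [BorelSpace V] [NormedAddCommGroup W]
    [InnerProductSpace ℝ W] [FiniteDimensional ℝ W] [MeasurableSpace W] [BorelSpace W]
    {T : W → V} {ι : V → W} (hT : Measurable T) (hadj : ∀ y t, ⟪T y, t⟫ = ⟪y, ι t⟫)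
    (hnorm : ∀ t, ‖ι t‖ = ‖t‖) : (stdGaussian W).map T = stdGaussian V := by
  have : IsProbabilityMeasure ((stdGaussian W).map T) :=
    Measure.isProbabilityMeasure_map hT.aemeasurable
  refine Measure.ext_of_charFun (funext fun t => ?_)
  rw [charFun_stdGaussian, charFun_apply, integral_map hT.aemeasurable (by fun_prop)]
  simp_rw [hadj]
  rw [← charFun_apply, charFun_stdGaussian, hnorm]

variable {m q : ℕ}

/-- The projection `E^{(q-1)} → E^{(m-1)}` that keeps the coordinates in the range of `σ` and
subtracts their mean. -/
noncomputable def marginal (σ : Fin m → Fin q) (y : E q) : E m :=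
  ⟨WithLp.toLp 2 fun k => y.1 (σ k) - (1 / m) * ∑ l, y.1 (σ l), by
    change ∑ k, (y.1 (σ k) - (1 / m : ℝ) * ∑ l, y.1 (σ l)) = 0
    rcases Nat.eq_zero_or_pos m with rfl | hm
    · simp
    · have : (m : ℝ) ≠ 0 := by positivity
      rw [Finset.sum_sub_distrib, Finset.sum_const, Finset.card_univ, Fintype.card_fin,
        nsmul_eq_mul]
      field_simp
      ring⟩

/-- Extension by zero `E^{(m-1)} → E^{(q-1)}` along `σ`. -/
noncomputable def zeroExtend (σ : Fin m → Fin q) (t : E m) : E q :=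
  ⟨∑ k, t.1 k • EuclideanSpace.single (σ k) 1, by
    change ∑ i, (∑ k, t.1 k • EuclideanSpace.single (σ k) (1 : ℝ) : EuclideanSpace ℝ (Fin q)) i = 0
    simp only [WithLp.ofLp_sum, Finset.sum_apply]
    rw [Finset.sum_comm]
    simp [sum_coord_eq_zero]⟩

lemma coord_marginal (σ : Fin m → Fin q) (y : E q) (k : Fin m) :
    (marginal σ y).1 k = y.1 (σ k) - (1 / m) * ∑ l, y.1 (σ l) := rfl

lemma inner_zeroExtend (σ : Fin m → Fin q) (y : E q) (t : E m) :
    ⟪y, zeroExtend σ t⟫ = ∑ k, t.1 k * y.1 (σ k) := by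
  rw [Submodule.coe_inner]
  change ⟪y.1, ∑ k, t.1 k • EuclideanSpace.single (σ k) (1 : ℝ)⟫ = _
  rw [inner_sum]
  refine Finset.sum_congr rfl fun k _ => ?_
  rw [inner_smul_right, EuclideanSpace.inner_single_right]
  simp

lemma coord_zeroExtend {σ : Fin m → Fin q} (hσ : Function.Injective σ) (t : E m) (k : Fin m) :
    (zeroExtend σ t).1 (σ k) = t.1 k := by
  change (∑ l, t.1 l • EuclideanSpace.single (σ l) (1 : ℝ) : EuclideanSpace ℝ (Fin q)) (σ k) = _
  simp [Pi.single_apply, hσ.eq_iff]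

lemma inner_marginal (σ : Fin m → Fin q) (y : E q) (t : E m) :
    ⟪marginal σ y, t⟫ = ⟪y, zeroExtend σ t⟫ := by
  rw [inner_zeroExtend, Submodule.coe_inner, PiLp.inner_apply]
  have : ∀ k, ⟪(marginal σ y).1 k, t.1 k⟫ =
      t.1 k * y.1 (σ k) - t.1 k * ((1 / m) * ∑ l, y.1 (σ l)) := fun k => by
    rw [coord_marginal, ← mul_sub]
    rfl
  simp_rw [this]
  rw [Finset.sum_sub_distrib, ← Finset.sum_mul, sum_coord_eq_zero, zero_mul, sub_zero]

lemma norm_zeroExtend {σ : Fin m → Fin q} (hσ : Function.Injective σ) (t : E m) :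
    ‖zeroExtend σ t‖ = ‖t‖ := by
  have h : ‖zeroExtend σ t‖ ^ 2 = ‖t‖ ^ 2 := by
    rw [← real_inner_self_eq_norm_sq, ← real_inner_self_eq_norm_sq, inner_zeroExtend,
      Submodule.coe_inner, PiLp.inner_apply]
    exact Finset.sum_congr rfl fun k _ => by rw [coord_zeroExtend hσ]; rfl
  exact (sq_eq_sq₀ (norm_nonneg _) (norm_nonneg _)).1 h

lemma measurable_marginal (σ : Fin m → Fin q) : Measurable (marginal σ) := by
  refine Continuous.measurable (Continuous.subtype_mk ?_ _)
  fun_prop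

lemma map_marginal_gauss {σ : Fin m → Fin q} (hσ : Function.Injective σ) :
    (gauss q).map (marginal σ) = gauss m :=
  map_adjoint_stdGaussian (measurable_marginal σ) (inner_marginal σ) (norm_zeroExtend hσ)

lemma expMax_eq_integral_comp (hm : 1 ≤ m) {σ : Fin m → Fin q} (hσ : Function.Injective σ)
    (x : EuclideanSpace ℝ (Fin m)) :
    expMax m x = ∫ y : E q, ⨆ k, (y.1 (σ k) - x k) ∂(gauss q) := by
  have : Nonempty (Fin m) := ⟨⟨0, hm⟩⟩
  have hmean : Integrable (fun y : E q => (1 / m : ℝ) * ∑ l, y.1 (σ l)) (gauss q) :=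
    (integrable_finsetSum _ fun l _ => integrable_coord (σ l)).const_mul _
  have hcont : Continuous fun z : E m => ⨆ k, (z.1 k - x k) :=
    continuous_iSup_coord (f := fun k (z : E m) => z.1 k - x k) fun k => by fun_prop
  rw [expMax, ← map_marginal_gauss hσ, integral_map (measurable_marginal σ).aemeasurable
    hcont.aestronglyMeasurable]
  have h : ∀ y : E q, ⨆ k, ((marginal σ y).1 k - x k) =
      (⨆ k, (y.1 (σ k) - x k)) - (1 / m : ℝ) * ∑ l, y.1 (σ l) := by
    intro y
    rw [eq_sub_iff_add_eq]
    refine (ciSup_add (Set.finite_range _).bddAbove _).trans ?_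
    refine iSup_congr fun k => ?_
    rw [coord_marginal]
    ring
  simp_rw [h]
  rw [integral_sub (integrable_iSup_coord σ x) hmean, integral_const_mul,
    integral_finsetSum _ fun l _ => integrable_coord (σ l)]
  simp [integral_coord]

lemma expMax_comp_le (hm : 1 ≤ m) {σ : Fin m → Fin q} (hσ : Function.Injective σ)
    (x : EuclideanSpace ℝ (Fin q)) : expMax m (WithLp.toLp 2 fun k => x (σ k)) ≤ expMax q x := by
  have : Nonempty (Fin m) := ⟨⟨0, hm⟩⟩
  have : Nonempty (Fin q) := ⟨σ ⟨0, hm⟩⟩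
  rw [expMax_eq_integral_comp hm hσ]
  refine integral_mono (integrable_iSup_coord σ _) (integrable_iSup_sub x) fun y =>
    ciSup_le fun k => le_iSup_coord (fun i => y.1 i - x i) (σ k)

/-- Sending the coordinates outside the range of `σ` to `+∞` removes them from the maximum. -/
lemma tendsto_expMax_extend (hm : 1 ≤ m) {σ : Fin m → Fin q} (hσ : Function.Injective σ)
    (x : EuclideanSpace ℝ (Fin m)) :
    Tendsto (fun n : ℕ => expMax q (WithLp.toLp 2 (Function.extend σ x fun _ => (n : ℝ)))) atTop
      (𝓝 (expMax m x)) := by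
  have : Nonempty (Fin m) := ⟨⟨0, hm⟩⟩
  have : Nonempty (Fin q) := ⟨σ ⟨0, hm⟩⟩
  let k₀ : Fin m := ⟨0, hm⟩
  rw [expMax_eq_integral_comp hm hσ]
  refine tendsto_integral_of_dominated_convergence (fun y => ‖y‖ + ‖x‖)
    (fun n => (integrable_iSup_sub _).aestronglyMeasurable)
    (integrable_norm_gauss.add (integrable_const _)) (fun n => ae_of_all _ fun y => ?_)
    (ae_of_all _ fun y => ?_)
  · have h1 : ∀ k, |y.1 (σ k) - x k| ≤ ‖y‖ + ‖x‖ := fun k =>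
      (abs_sub _ _).trans (add_le_add (abs_coord_E_le y _) (abs_coord_le x k))
    refine abs_le.2 ⟨?_, ciSup_le fun i => ?_⟩
    · refine (neg_le_of_abs_le (h1 k₀)).trans ?_
      have := le_iSup_coord (fun i => y.1 i - Function.extend σ x (fun _ => (n : ℝ)) i) (σ k₀)
      simpa only [hσ.extend_apply] using this
    · by_cases hi : ∃ k, σ k = i
      · obtain ⟨k, rfl⟩ := hi
        simpa only [hσ.extend_apply] using le_of_abs_le (h1 k)
      · change y.1 i - Function.extend σ x (fun _ => (n : ℝ)) i ≤ _
        rw [Function.extend_apply' _ _ _ hi]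
        have h2 := le_of_abs_le (abs_coord_E_le y i)
        have h3 : (0 : ℝ) ≤ n := n.cast_nonneg
        linarith [norm_nonneg x]
  · refine tendsto_const_nhds.congr' ?_
    have hev : ∀ᶠ n : ℕ in atTop, ∀ i : Fin q, y.1 i - (y.1 (σ k₀) - x k₀) ≤ n :=
      eventually_all.2 fun i => tendsto_natCast_atTop_atTop.eventually_ge_atTop _
    filter_upwards [hev] with n hn
    refine le_antisymm (ciSup_le fun k => ?_) (ciSup_le fun i => ?_)
    · have := le_iSup_coord (fun i => y.1 i - Function.extend σ x (fun _ => (n : ℝ)) i) (σ k)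
      simpa only [hσ.extend_apply] using this
    · by_cases hi : ∃ k, σ k = i
      · obtain ⟨k, rfl⟩ := hi
        simpa only [hσ.extend_apply] using le_iSup_coord (fun k => y.1 (σ k) - x k) k
      · change y.1 i - Function.extend σ x (fun _ => (n : ℝ)) i ≤ _
        rw [Function.extend_apply' _ _ _ hi]
        have := le_iSup_coord (fun k => y.1 (σ k) - x k) k₀
        linarith [hn i]

lemma sum_comp_eq {σ : Fin m → Fin q} (hσ : Function.Injective σ) {f : Fin q → ℝ}
    (hf : ∀ i, (¬ ∃ k, σ k = i) → f i = 0) : ∑ k, f (σ k) = ∑ i, f i := by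
  rw [← Finset.sum_image (s := Finset.univ) (g := σ) fun a _ b _ h => hσ h]
  refine Finset.sum_subset (Finset.subset_univ _) fun i _ hi => hf i fun ⟨k, hk⟩ => hi ?_
  exact Finset.mem_image.2 ⟨k, Finset.mem_univ k, hk⟩

lemma expMaxEnvelope_comp (hm : 1 ≤ m) {σ : Fin m → Fin q} (hσ : Function.Injective σ)
    {v : EuclideanSpace ℝ (Fin q)} (hv : v ∈ simplex q) (hv0 : ∀ i, (¬ ∃ k, σ k = i) → v i = 0) :
    expMaxEnvelope q v = expMaxEnvelope m (WithLp.toLp 2 fun k => v (σ k)) := by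
  have : Nonempty (Fin m) := ⟨⟨0, hm⟩⟩
  have : Nonempty (Fin q) := ⟨σ ⟨0, hm⟩⟩
  have hvm : (WithLp.toLp 2 fun k => v (σ k)) ∈ simplex m :=
    ⟨fun k => hv.1 _, (sum_comp_eq hσ hv0).trans hv.2⟩
  have hin : ∀ x : EuclideanSpace ℝ (Fin q), ⟪v, x⟫ =
      ⟪(WithLp.toLp 2 fun k => v (σ k) : EuclideanSpace ℝ (Fin m)),
        WithLp.toLp 2 fun k => x (σ k)⟫ := by
    intro x
    rw [PiLp.inner_apply, PiLp.inner_apply]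
    refine (sum_comp_eq hσ (f := fun i => ⟪v i, x i⟫) fun i hi => ?_).symm
    rw [hv0 i hi, inner_zero_left]
  refine le_antisymm (le_ciInf fun x => ?_) (le_ciInf fun x => ?_)
  · refine ge_of_tendsto' ((tendsto_expMax_extend hm hσ x).add_const _) fun n => ?_
    refine (expMaxEnvelope_le hv
      (WithLp.toLp 2 (Function.extend σ x fun _ => (n : ℝ)))).trans_eq ?_
    rw [hin]
    congr 3
    ext k
    exact hσ.extend_apply x.ofLp (fun _ => (n : ℝ)) k
  · rw [hin]
    exact (expMaxEnvelope_le hvm _).trans (add_le_add_left (expMax_comp_le hm hσ x) _)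

lemma expMaxEnvelope_face {J : Finset (Fin q)} (hJ : 0 < J.card) {v : EuclideanSpace ℝ (Fin q)}
    (hv : v ∈ face q J) :
    (1 / √2) * expMaxEnvelope q v = modelProfile J.card (faceProj J v) := by
  have hpos : ∀ i, 0 < v i ↔ i ∈ J := fun i => by
    have := congrArg (fun s : Set (Fin q) => i ∈ s) hv.2
    simpa using this
  have hσ : Function.Injective (J.orderEmbOfFin rfl) := (J.orderEmbOfFin rfl).injective
  have hv0 : ∀ i, (¬ ∃ k, J.orderEmbOfFin rfl k = i) → v i = 0 := by
    intro i hi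
    refine le_antisymm (not_lt.1 fun h => hi ?_) (hv.1.1 i)
    have h1 : i ∈ Set.range (J.orderEmbOfFin rfl) := by
      rw [Finset.range_orderEmbOfFin]
      exact (hpos i).1 h
    exact h1
  have hint : faceProj J v ∈ simplexInterior J.card :=
    ⟨fun k => (hpos _).2 (J.orderEmbOfFin_mem rfl k), (sum_comp_eq hσ hv0).trans hv.1.2⟩
  rw [← modelProfile_eq_expMaxEnvelope hJ hint, expMaxEnvelope_comp hJ hσ hv.1 hv0]
  rfl

end Faces

end GaussianBubble

open GaussianBubble
theorem proposition2p4 (q : ℕ) (hq : 2 ≤ q) :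
    -- `Ψ` is a diffeomorphism from `E` onto the interior of the simplex, with the stated
    -- differential; smoothness on the interior of the simplex is smoothness in the affine
    -- charts `E ∋ w ↦ v + w` of the hyperplane that contains the simplex
    (ContDiff ℝ ∞ (Psi q) ∧
      BijOn (Psi q) univ (simplexInterior q) ∧
      (∀ v ∈ simplexInterior q, ContDiffAt ℝ ∞ (fun w : E q => PsiInv q (v + w)) 0) ∧
      (∀ x : E q, HasFDerivAt (Psi q)
        ((E q).subtypeL ∘L (-(1 / √2 : ℝ) • L q (modelArea q x))) x)) ∧
    -- the perimeter of a model cluster is finite and is the total weighted area of its interfaces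
    (∀ x : E q,
      clusterPerimeter q (fun i => shift x (modelCell q i)) ≠ ⊤ ∧
      clusterPerimeter q (fun i => shift x (modelCell q i)) =
        ∑ i, ∑ j with i < j, gaussSurface q (shift x (modelInterface q i j))) ∧
    -- the model profile is smooth on the interior of the simplex
    (∀ v ∈ simplexInterior q, ContDiffAt ℝ ∞ (fun w : E q => modelProfile q (v + w)) 0) ∧
    -- it extends continuously to the simplex, with the lower-dimensional profiles on the faces
    (∃ I : EuclideanSpace ℝ (Fin q) → ℝ,
      ContinuousOn I (simplex q) ∧
      EqOn I (modelProfile q) (simplexInterior q) ∧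
      ∀ J : Finset (Fin q), 0 < J.card → J.card < q →
        ∀ v ∈ face q J, I v = modelProfile J.card (faceProj J v)) ∧
    -- its gradient and Hessian on `E`
    (∀ v ∈ simplexInterior q,
      HasGradientAt (fun w : E q => modelProfile q (v + w)) ((1 / √2 : ℝ) • PsiInv q v) 0 ∧
      (L q (modelArea q (PsiInv q v))).IsInvertible ∧
      HasFDerivAt (gradient fun w : E q => modelProfile q (v + w))
        (-(L q (modelArea q (PsiInv q v))).inverse) 0) := by
  have hq1 : 1 ≤ q := one_le_two.trans hq
  have : Nonempty (Fin q) := ⟨⟨0, hq1⟩⟩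
  refine ⟨⟨contDiff_Psi, bijOn_Psi hq1, fun v hv => (PsiInv_add hq1 hv).1, hasFDerivAt_Psi⟩,
    fun x => ⟨clusterPerimeter_cells_ne_top x, clusterPerimeter_cells x⟩,
    fun v hv => contDiffAt_modelProfile hq1 hv,
    ⟨fun v => (1 / √2) * expMaxEnvelope q v, continuousOn_const.mul continuousOn_expMaxEnvelope,
      fun v hv => modelProfile_eq_expMaxEnvelope hq1 hv,
      fun J hJ _ v hv => expMaxEnvelope_face hJ hv⟩,
    fun v hv => ⟨hasGradientAt_modelProfile_zero hq1 hv, isInvertible_L_modelArea _,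
      hasFDerivAt_gradient_modelProfile hq1 hv⟩⟩
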